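/- Let $K$ be a field with a discrete valuation $v\colon K^*\to\mathbb Z$, $v(K^*)=\mathbb Z$. Let $K_v$ be its completion, $\mathcal O_v$ the valuation ring of $K_v$, and denote again by $v\colon\overline K_v\to\mathbb Q\cup\{\infty\}$ the unique extension of $v$ to an algebraic closure of $K_v$. *Valuations.* For $k\in\{K,K_v\}$ consider the discrete valuations $\mu\colon k(x)^*\to\mathbb Q$ that extend $v$ and satisfy $\mu(x)\ge0$. For $\alpha\in\mathbb Q$ let $\mathcal P_\alpha=\{g\in k[x]:\mu(g)\ge\alpha\}$, $\mathcal P_\alpha^+=\{g\in k[x]:\mu(g)>\alpha\}$, let $\mathcal Gr(\mu)=\bigoplus_\alpha\mathcal P_\alpha/\mathcal P_\alpha^+$ be the graded algebra, $\Delta(\mu)=\mathcal P_0/\mathcal P_0^+$ its degree-zero subring, and let $H_\mu(g)=g+\mathcal P^+_{\mu(g)}$ for $g\neq 0$, $H_\mu(0)=0$. Write $g\sim_\mu h$ if $H_\mu(g)=H_\mu(h)$; $h\mid_\mu g$ if $H_\mu(h)$ divides $H_\mu(g)$ in $\mathcal Gr(\mu)$; and $\mathcal R(g)=\Delta(\mu)\cap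 H_\mu(g)\mathcal Gr(\mu)$. A polynomial $\phi\in k[x]$ is *$\mu$-minimal* if $\deg\phi>0$ and $\phi\nmid_\mu g$ for all non-zero $g\in k[x]$ with $\deg g<\deg\phi$. A *key polynomial* for $\mu$ is a monic $\mu$-minimal $\phi\in k[x]$ such that $H_\mu(\phi)\mathcal Gr(\mu)$ is a non-zero prime ideal. For a monic $\phi$ of positive degree, every $g\in k[x]$ has a unique $\phi$-expansion $g=\sum_{s\ge0}a_s\phi^s$ with $\deg a_s<\deg\phi$. If $\phi$ is a key polynomial for $\mu$ and $\lambda\in\mathbb Q_{>0}$, the augmented valuation $[\mu;(\phi,\lambda)]$ is given by $g\mapsto\min_s\{\mu(a_s\phi^s)+s\lambda\}$ on $k[x]$. A valuation is *inductive* if it is obtained by finitely many (possibly zero) augmentations from $\mu_0\colon\sum_s c_sx^s\mapsto\min_s v(c_s)$. *Newton polygons.* $N_{\mu,\phi}(g)$ is the lower convex hull in $\mathbb R^2$ of the points $(s,\mu(a_s\phi^s))$ with $a_s\ne0$, where $g=\sum_s a_s\phi^s$ is the $\phi$-expansion. Its length $\ell(N_{\mu,\phi}(g))$ is the abscissa of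 its right end point. It is *one-sided of slope $-\lambda$* if it coincides with the set of its points at which $y+\lambda x$ is minimal, its left end point has abscissa $0$, and its right end point has positive abscissa. **Theorem.** Let $F\in\mathcal O_v[x]$ be a prime polynomial (i.e. monic and irreducible in $\mathcal O_v[x]$), $\theta\in\overline K_v$ a root of $F$, $\mu$ an inductive valuation on $K(x)$, and $\phi\in K[x]$ a key polynomial for $\mu$. Then there is a unique inductive valuation on $K_v(x)$ whose restriction to $K(x)$ is $\mu$. Denoting it again by $\mu$ and using it in everything that follows (so that $\mid_\mu$, $\sim_\mu$, $\mu$-minimality, $\mathcal R$ and $N_{\mu,\phi}$ refer to polynomials in $K_v[x]$), we have $$\phi\mid_\mu F\iff v(\phi(\theta))>\mu(\phi).$$ Moreover, if this condition holds, then: 1. Either $F=\phi$, or $\lambda:=v(\phi(\theta))-\mu(\phi)$ is a positive rational number and $N_{\mu,\phi}(F)$ is one-sided of slope $-\lambda$. 2. Let $\ell=\ell(N_{\mu,\phi}(F))$. Then $\ell$ is a non-negative integer, $\deg F=\ell\deg\phi$, and $F$ is $\mu$-minimal. 3. $F\sim_\mu\phi^\ell$; moreover $\mathcal R(\phi)$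 is a maximal ideal of $\Delta(\mu)$ and $\mathcal R(F)=\mathcal R(\phi)^n$ for some integer $n\ge1$. -/

import Mathlib

open Polynomial
open scoped DirectSum WithZero

noncomputable section

namespace MacLane

/-- The additive, `ℚ ∪ {∞}`-valued form of an element of `ℤᵐ⁰`: `0` is sent to `∞` and
`exp n` is sent to `-n`. -/
def addVal (a : ℤᵐ⁰) : WithTop ℚ :=
  if a = 0 then ⊤ else (((-WithZero.log a : ℤ) : ℚ) : WithTop ℚ)

section Expansion

variable {k : Type*} [Field k]

/-- The `s`-th coefficient `a_s` (`deg a_s < deg φ`) of the canonical `φ`-expansion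
`g = ∑ a_s φ ^ s`, for a monic `φ` of positive degree. -/
def expCoeff (φ g : k[X]) (s : ℕ) : k[X] :=
  ((fun h : k[X] => h /ₘ φ)^[s] g) %ₘ φ

/-- The canonical expansion: `g = ∑ a_s φ ^ s`. -/
theorem sum_expCoeff_add (φ g : k[X]) (n : ℕ) :
    ∑ s ∈ Finset.range n, expCoeff φ g s * φ ^ s
      + ((fun h : k[X] => h /ₘ φ)^[n] g) * φ ^ n = g := by
  induction n with
  | zero => simp
  | succ n ih =>
    rw [Finset.sum_range_succ, Function.iterate_succ_apply', pow_succ]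
    conv_rhs => rw [← ih]
    have h := Polynomial.modByMonic_add_div ((fun h : k[X] => h /ₘ φ)^[n] g) φ
    unfold expCoeff
    conv_rhs => rw [← h]
    ring

/-- The minimal (Gauss) valuation on polynomials: the minimum of the values of the coefficients. -/
def gauss (w : Valuation k ℤᵐ⁰) (g : k[X]) : WithTop ℚ :=
  g.support.inf fun s => addVal (w (g.coeff s))

end Expansion

/-- The set `𝕍` of (discrete, `ℚ`-valued) valuations `μ` on `k(x)` which extend the valuation
`w` of `k` and satisfy `μ(x) ≥ 0`. -/
@[ext]
structure RatVal {k : Type*} [Field k] (w : Valuation k ℤᵐ⁰) where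
  /-- the valuation on `k(x)` -/
  val : AddValuation (RatFunc k) (WithTop ℚ)
  extends_base : ∀ a : k, val (RatFunc.C a) = addVal (w a)
  nonneg_X : 0 ≤ val RatFunc.X
  discrete : ∃ e : ℕ, 0 < e ∧ ∀ f : RatFunc k, f ≠ 0 →
    ∃ n : ℤ, val f = (((n : ℚ) / (e : ℚ) : ℚ) : WithTop ℚ)

namespace RatVal

variable {k : Type*} [Field k] {w : Valuation k ℤᵐ⁰} (μ : RatVal w)

/-- The value `μ(g) ∈ ℚ ∪ {∞}` of a polynomial. -/
def pval (g : k[X]) : WithTop ℚ := μ.val (algebraMap k[X] (RatFunc k) g)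

theorem pval_zero : μ.pval 0 = ⊤ := by simp [pval]

theorem pval_one : μ.pval 1 = 0 := by simp [pval]

theorem pval_mul (g h : k[X]) : μ.pval (g * h) = μ.pval g + μ.pval h := by simp [pval]

theorem pval_add (g h : k[X]) : min (μ.pval g) (μ.pval h) ≤ μ.pval (g + h) := by
  rw [pval, pval, pval, map_add]
  exact μ.val.map_add _ _

theorem pval_neg (g : k[X]) : μ.pval (-g) = μ.pval g := by
  simp [pval, AddValuation.map_neg]

/-- The value of a non-zero polynomial as a rational number (with the convention `0` for `g = 0`,
which is never relied upon). -/
def qval (g : k[X]) : ℚ := (μ.pval g).untopD 0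

theorem qval_le_pval (g : k[X]) : ((μ.qval g : ℚ) : WithTop ℚ) ≤ μ.pval g := by
  unfold qval
  cases h : μ.pval g with
  | top => simp
  | coe a => simp

/-! ### The graded algebra -/

/-- `𝒫_α = {g ∈ k[x] | μ(g) ≥ α}`. -/
def P (α : ℚ) : AddSubgroup k[X] where
  carrier := {g | (α : WithTop ℚ) ≤ μ.pval g}
  add_mem' {a b} ha hb := le_trans (le_min ha hb) (μ.pval_add a b)
  zero_mem' := by simp [pval_zero]
  neg_mem' {a} ha := by simpa [pval_neg] using ha

theorem self_mem_P (g : k[X]) : g ∈ μ.P (μ.qval g) := μ.qval_le_pval g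

/-- `𝒫_α⁺ = {g ∈ k[x] | μ(g) > α}`. -/
def PPlus (α : ℚ) : AddSubgroup k[X] where
  carrier := {g | (α : WithTop ℚ) < μ.pval g}
  add_mem' {a b} ha hb := lt_of_lt_of_le (lt_min ha hb) (μ.pval_add a b)
  zero_mem' := by simp [pval_zero, WithTop.coe_lt_top]
  neg_mem' {a} ha := by simpa [pval_neg] using ha

/-- The graded piece `𝒫_α / 𝒫_α⁺`. -/
abbrev Piece (α : ℚ) : Type _ := μ.P α ⧸ (μ.PPlus α).addSubgroupOf (μ.P α)

/-- The class `g + 𝒫_α⁺` of an element `g` of `𝒫_α`. -/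
def cls {α : ℚ} (g : μ.P α) : μ.Piece α := QuotientAddGroup.mk g

theorem cls_eq_cls {α : ℚ} (g h : μ.P α) :
    μ.cls g = μ.cls h ↔ (α : WithTop ℚ) < μ.pval (g.1 - h.1) := by
  unfold cls
  rw [QuotientAddGroup.eq, AddSubgroup.mem_addSubgroupOf, ← μ.pval_neg (g.1 - h.1)]
  have : -(g.1 - h.1) = ((-g + h : μ.P α) : k[X]) := by
    simp; ring
  rw [this]
  rfl

theorem cls_surjective {α : ℚ} (a : μ.Piece α) : ∃ g, μ.cls g = a :=
  QuotientAddGroup.mk_surjective a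

theorem cls_zero {α : ℚ} : μ.cls (0 : μ.P α) = 0 := rfl

theorem cls_add {α : ℚ} (g h : μ.P α) : μ.cls (g + h) = μ.cls g + μ.cls h := rfl

theorem cls_neg {α : ℚ} (g : μ.P α) : μ.cls (-g) = -μ.cls g := rfl

theorem mk_cls_ext {α β : ℚ} (hαβ : α = β) (g : μ.P α) (h : μ.P β) (hgh : g.1 = h.1) :
    (GradedMonoid.mk α (μ.cls g) : GradedMonoid μ.Piece) = GradedMonoid.mk β (μ.cls h) := by
  subst hαβ
  obtain rfl : g = h := Subtype.ext hgh
  rfl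

/-- The product `𝒫_α × 𝒫_β → 𝒫_{α+β}`. -/
def pmul {α β : ℚ} (g : μ.P α) (h : μ.P β) : μ.P (α + β) :=
  ⟨g.1 * h.1, by
    have h1 : (α : WithTop ℚ) ≤ μ.pval g.1 := g.2
    have h2 : (β : WithTop ℚ) ≤ μ.pval h.1 := h.2
    change ((α + β : ℚ) : WithTop ℚ) ≤ μ.pval (g.1 * h.1)
    rw [pval_mul, WithTop.coe_add]
    exact add_le_add h1 h2⟩

/-- The unit `1 ∈ 𝒫_0`. -/
def pone : μ.P 0 := ⟨1, by change ((0 : ℚ) : WithTop ℚ) ≤ μ.pval 1; simp [pval_one]⟩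

/-- Multiplication of classes: `(g + 𝒫_α⁺)(h + 𝒫_β⁺) = gh + 𝒫_{α+β}⁺`. -/
def gmul {α β : ℚ} (a : μ.Piece α) (b : μ.Piece β) : μ.Piece (α + β) :=
  Quotient.liftOn₂' a b (fun g h => μ.cls (μ.pmul g h)) (by
    intro g₁ h₁ g₂ h₂ hg hh
    have hg' := (μ.cls_eq_cls g₁ g₂).1 (Quotient.sound' hg)
    have hh' := (μ.cls_eq_cls h₁ h₂).1 (Quotient.sound' hh)
    rw [cls_eq_cls]
    have e : (μ.pmul g₁ h₁).1 - (μ.pmul g₂ h₂).1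
        = (g₁.1 - g₂.1) * h₁.1 + g₂.1 * (h₁.1 - h₂.1) := by
      simp only [pmul]; ring
    rw [e]
    refine lt_of_lt_of_le (lt_min ?_ ?_) (μ.pval_add _ _)
    · rw [pval_mul, WithTop.coe_add]
      exact WithTop.add_lt_add_of_lt_of_le WithTop.coe_ne_top hg' h₁.2
    · rw [pval_mul, WithTop.coe_add]
      exact WithTop.add_lt_add_of_le_of_lt WithTop.coe_ne_top g₂.2 hh')

theorem gmul_cls {α β : ℚ} (g : μ.P α) (h : μ.P β) :
    μ.gmul (μ.cls g) (μ.cls h) = μ.cls (μ.pmul g h) := rfl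

/-- `n ∈ 𝒫_0` for every natural number `n`. -/
def pnat : ℕ → μ.P 0
  | 0 => 0
  | n + 1 => pnat n + μ.pone

instance : GradedMonoid.GOne μ.Piece := ⟨μ.cls μ.pone⟩

instance : GradedMonoid.GMul μ.Piece := ⟨μ.gmul⟩

instance : DirectSum.GCommRing μ.Piece where
  mul_zero {i j} a := by
    obtain ⟨g, rfl⟩ := μ.cls_surjective a
    exact congrArg μ.cls (Subtype.ext (mul_zero g.1) : μ.pmul g (0 : μ.P j) = 0)
  zero_mul {i j} a := by
    obtain ⟨g, rfl⟩ := μ.cls_surjective a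
    exact congrArg μ.cls (Subtype.ext (zero_mul g.1) : μ.pmul (0 : μ.P i) g = 0)
  mul_add {i j} a b c := by
    obtain ⟨a, rfl⟩ := μ.cls_surjective a
    obtain ⟨b, rfl⟩ := μ.cls_surjective b
    obtain ⟨c, rfl⟩ := μ.cls_surjective c
    exact congrArg μ.cls
      (Subtype.ext (mul_add a.1 b.1 c.1) : μ.pmul a (b + c) = μ.pmul a b + μ.pmul a c)
  add_mul {i j} a b c := by
    obtain ⟨a, rfl⟩ := μ.cls_surjective a
    obtain ⟨b, rfl⟩ := μ.cls_surjective b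
    obtain ⟨c, rfl⟩ := μ.cls_surjective c
    exact congrArg μ.cls
      (Subtype.ext (add_mul a.1 b.1 c.1) : μ.pmul (a + b) c = μ.pmul a c + μ.pmul b c)
  one_mul := by
    rintro ⟨i, a⟩
    obtain ⟨a, rfl⟩ := μ.cls_surjective a
    exact μ.mk_cls_ext (zero_add _) (μ.pmul μ.pone a) a (one_mul _)
  mul_one := by
    rintro ⟨i, a⟩
    obtain ⟨a, rfl⟩ := μ.cls_surjective a
    exact μ.mk_cls_ext (add_zero _) (μ.pmul a μ.pone) a (mul_one _)
  mul_assoc := by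
    rintro ⟨i, a⟩ ⟨j, b⟩ ⟨l, c⟩
    obtain ⟨a, rfl⟩ := μ.cls_surjective a
    obtain ⟨b, rfl⟩ := μ.cls_surjective b
    obtain ⟨c, rfl⟩ := μ.cls_surjective c
    exact μ.mk_cls_ext (add_assoc _ _ _) (μ.pmul (μ.pmul a b) c) (μ.pmul a (μ.pmul b c))
      (mul_assoc _ _ _)
  mul_comm := by
    rintro ⟨i, a⟩ ⟨j, b⟩
    obtain ⟨a, rfl⟩ := μ.cls_surjective a
    obtain ⟨b, rfl⟩ := μ.cls_surjective b
    exact μ.mk_cls_ext (add_comm _ _) (μ.pmul a b) (μ.pmul b a) (mul_comm _ _)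
  natCast n := μ.cls (μ.pnat n)
  natCast_zero := rfl
  natCast_succ _ := rfl
  intCast n := match n with
    | Int.ofNat n => μ.cls (μ.pnat n)
    | Int.negSucc n => -μ.cls (μ.pnat (n + 1))
  intCast_ofNat _ := rfl
  intCast_negSucc_ofNat _ := rfl

/-- The graded algebra `𝒢r(μ) = ⨁_α 𝒫_α / 𝒫_α⁺`. All pieces with `α` outside the value group
`Γ(μ)` vanish, so that the sum may be taken over all rational numbers `α`. -/
abbrev Gr : Type _ := ⨁ α : ℚ, μ.Piece α

/-- The degree-zero subring `Δ(μ) = 𝒫_0 / 𝒫_0⁺` of `𝒢r(μ)`. -/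
abbrev Delta : Type _ := μ.Piece 0

/-- `H_μ(g) = g + 𝒫_{μ(g)}⁺`, placed in degree `μ(g)`; in particular `H_μ(0) = 0`. -/
def H (g : k[X]) : μ.Gr :=
  DirectSum.of μ.Piece (μ.qval g) (μ.cls ⟨g, μ.self_mem_P g⟩)

/-- `g ∼_μ h`: `μ`-equivalence. -/
def Equivalent (g h : k[X]) : Prop := μ.H g = μ.H h

/-- `h ∣_μ g`: `μ`-divisibility. -/
def Divides (h g : k[X]) : Prop := μ.H h ∣ μ.H g

/-- `φ` is `μ`-irreducible. -/
def IsIrreducible (φ : k[X]) : Prop :=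
  Ideal.span {μ.H φ} ≠ ⊥ ∧ (Ideal.span {μ.H φ}).IsPrime

/-- `φ` is `μ`-minimal. -/
def IsMinimal (φ : k[X]) : Prop :=
  0 < φ.natDegree ∧ ∀ g : k[X], g ≠ 0 → g.natDegree < φ.natDegree → ¬ μ.Divides φ g

/-- `φ` is a key polynomial for `μ`. -/
def IsKey (φ : k[X]) : Prop :=
  φ.Monic ∧ μ.IsMinimal φ ∧ μ.IsIrreducible φ

/-- The residual ideal `ℛ_μ(g) = Δ(μ) ∩ H_μ(g) 𝒢r(μ)`. -/
def residualIdeal (g : k[X]) : Ideal μ.Delta :=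
  (Ideal.span {μ.H g}).comap (DirectSum.ofZeroRingHom μ.Piece)

/-! ### Augmentation and inductive valuations -/

/-- `μ' = [μ; (φ, l)]`: on polynomials, `μ'(g) = min_s (μ(a_s φ^s) + s l)`, where `∑ a_s φ^s` is
the canonical `φ`-expansion of `g` (whose coefficients `a_s` vanish for `s > deg g`). -/
def IsAugmentation (φ : k[X]) (l : ℚ) (μ' : RatVal w) : Prop :=
  ∀ g : k[X], μ'.pval g = (Finset.range (g.natDegree + 1)).inf fun s =>
    μ.pval (expCoeff φ g s * φ ^ s) + (((s : ℚ) * l : ℚ) : WithTop ℚ)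

/-- Inductive valuations: those obtained from the minimal valuation `μ₀` after finitely many
augmentation steps. -/
inductive IsInductive : RatVal w → Prop
  | minimal (μ : RatVal w) (h : ∀ g : k[X], μ.pval g = gauss w g) : IsInductive μ
  | augment (μ μ' : RatVal w) (φ : k[X]) (l : ℚ) (hμ : IsInductive μ) (hφ : μ.IsKey φ)
      (hl : 0 < l) (h : μ.IsAugmentation φ l μ') : IsInductive μ'

/-! ### Newton polygons -/

/-- The cloud of points `(s, μ(a_s φ^s))`, `a_s ≠ 0`, attached to the `φ`-expansion of `g`. -/
def cloud (φ g : k[X]) : Set (ℝ × ℝ) :=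
  {p | ∃ s : ℕ, expCoeff φ g s ≠ 0 ∧ p = ((s : ℝ), ((μ.qval (expCoeff φ g s * φ ^ s) : ℚ) : ℝ))}

/-- The Newton polygon `N_{μ,φ}(g)`: the lower convex hull of the cloud of points. -/
def newton (φ g : k[X]) : Set (ℝ × ℝ) :=
  {p | p ∈ convexHull ℝ (μ.cloud φ g) ∧
    ∀ y : ℝ, (p.1, y) ∈ convexHull ℝ (μ.cloud φ g) → p.2 ≤ y}

end RatVal

/-- The `l`-component of a polygon `N`: the points of `N` where `y + l x` is minimal. -/
def component (N : Set (ℝ × ℝ)) (l : ℝ) : Set (ℝ × ℝ) :=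
  {p | p ∈ N ∧ ∀ q ∈ N, p.2 + l * p.1 ≤ q.2 + l * q.1}

/-- `N` is one-sided of slope `-l`: it equals its `l`-component, whose end points have abscissas
`0` and some `t > 0`. -/
def IsOneSided (N : Set (ℝ × ℝ)) (l : ℝ) : Prop :=
  N = component N l ∧ IsLeast (Prod.fst '' component N l) 0 ∧
    ∃ t : ℝ, IsGreatest (Prod.fst '' component N l) t ∧ 0 < t

/-- `t` is the length of the polygon `N`, i.e. the abscissa of its right end point. -/
def IsLength (N : Set (ℝ × ℝ)) (t : ℝ) : Prop := IsGreatest (Prod.fst '' N) t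

/-- The canonical extension of the valuation `w` of a complete field `k` to an algebraic
extension `Ω` of `k`, with values in `ℚ ∪ {∞}`: the value of `y` is
`w(N(y)) / [k(y) : k]`, where `± N(y)` is the constant term of the minimal polynomial of `y`. -/
def algVal {k : Type*} [Field k] (w : Valuation k ℤᵐ⁰) {Ω : Type*} [Field Ω] [Algebra k Ω]
    (y : Ω) : WithTop ℚ :=
  (addVal (w ((minpoly k y).coeff 0))).map fun q => q / ((minpoly k y).natDegree : ℚ)

section Completion

variable {K : Type*} [Field K] (v : Valuation K ℤᵐ⁰)

/-- The valuation of the completion `K_v`. -/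
abbrev complVal : Valuation v.Completion ℤᵐ⁰ := Valued.v

/-- The canonical inclusion `K ⊂ K_v`. -/
def toCompl : K →+* v.Completion :=
  (UniformSpace.Completion.coeRingHom (α := WithVal v)).comp
    (WithVal.equiv v).symm.toRingHom

variable {v}

/-- `μ'` is the natural extension to `K_v(x)` of the valuation `μ` of `K(x)`: it is inductive and
it restricts to `μ`. -/
def IsNaturalExtension (μ : RatVal v) (μ' : RatVal (complVal v)) : Prop :=
  μ'.IsInductive ∧ ∀ g : K[X], μ'.pval (g.map (toCompl v)) = μ.pval g

end Completion

end MacLane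

end

/-!
Since `K[x]` is dense in `K_v[x]`, an inductive valuation of `K(x)` and an extension of it to
`K_v(x)` have the same graded algebra; key polynomials therefore remain key polynomials over `K_v`,
and the extension is obtained by repeating the same augmentation steps there.

Over `K_v`, `φ ∣_μ g` means that augmenting `μ` along `φ` increases the value of `g`, which is how
divisibility is compared with values at roots. All roots of `F` are conjugate, so `φ` takes the same
value `v(φ(θ))` at each of them. If `φ ∣_μ F`, this forces the `φ`-Newton polygon of `F` to be a
single segment ending at a monic term `φ ^ ℓ`, and under `μ` that term has strictly smaller value
than all others, whence `F ∼_μ φ ^ ℓ`.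
-/

noncomputable section

namespace MacLane

theorem addVal_zero : addVal 0 = ⊤ := by simp [addVal]

theorem addVal_one : addVal 1 = 0 := by simp [addVal]

theorem addVal_of_ne_zero {a : ℤᵐ⁰} (ha : a ≠ 0) :
    addVal a = (((-WithZero.log a : ℤ) : ℚ) : WithTop ℚ) := by simp [addVal, ha]

theorem addVal_eq_top_iff {a : ℤᵐ⁰} : addVal a = ⊤ ↔ a = 0 := by
  by_cases ha : a = 0
  · simp [ha, addVal_zero]
  · simp [ha, addVal_of_ne_zero ha]

theorem addVal_mul (a b : ℤᵐ⁰) : addVal (a * b) = addVal a + addVal b := by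
  by_cases ha : a = 0
  · simp [ha, addVal_zero]
  by_cases hb : b = 0
  · simp [hb, addVal_zero]
  rw [addVal_of_ne_zero ha, addVal_of_ne_zero hb, addVal_of_ne_zero (mul_ne_zero ha hb),
    WithZero.log_mul ha hb, neg_add, Int.cast_add, WithTop.coe_add]

theorem addVal_le_addVal_iff {a b : ℤᵐ⁰} : addVal a ≤ addVal b ↔ b ≤ a := by
  by_cases hb : b = 0
  · simp [hb, addVal_zero]
  by_cases ha : a = 0
  · simp [ha, addVal_zero, addVal_eq_top_iff]
  rw [addVal_of_ne_zero ha, addVal_of_ne_zero hb, WithTop.coe_le_coe, Int.cast_le, neg_le_neg_iff,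
    WithZero.log_le_log hb ha]

theorem addVal_lt_addVal_iff {a b : ℤᵐ⁰} : addVal a < addVal b ↔ b < a :=
  lt_iff_lt_of_le_iff_le addVal_le_addVal_iff

section Gauss

variable {k : Type*} [Field k] (w : Valuation k ℤᵐ⁰)

/-- The additive form, with values in `ℚ ∪ {∞}`, of a discrete valuation. -/
def addValuation : AddValuation k (WithTop ℚ) :=
  .of (fun a => addVal (w a)) (by simp [addVal_zero]) (by simp [addVal_one])
    (fun a b => min_le_iff.2 <| (le_max_iff.1 (w.map_add a b)).imp
      addVal_le_addVal_iff.2 addVal_le_addVal_iff.2)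
    (fun a b => by rw [map_mul, addVal_mul])

theorem addValuation_apply (a : k) : addValuation w a = addVal (w a) := rfl

variable {w}

theorem le_gauss_iff {T : WithTop ℚ} {g : k[X]} :
    T ≤ gauss w g ↔ ∀ i, T ≤ addVal (w (g.coeff i)) := by
  rw [gauss, Finset.le_inf_iff]
  refine ⟨fun h i => ?_, fun h i _ => h i⟩
  by_cases hi : i ∈ g.support
  · exact h i hi
  · simp [Polynomial.notMem_support_iff.1 hi, addVal_zero]

theorem lt_gauss_iff {T : WithTop ℚ} (hT : T ≠ ⊤) {g : k[X]} :
    T < gauss w g ↔ ∀ i, T < addVal (w (g.coeff i)) := by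
  rw [gauss, Finset.lt_inf_iff hT.lt_top]
  refine ⟨fun h i => ?_, fun h i _ => h i⟩
  by_cases hi : i ∈ g.support
  · exact h i hi
  · simpa [Polynomial.notMem_support_iff.1 hi, addVal_zero] using hT.lt_top

theorem gauss_le_coeff (g : k[X]) (i : ℕ) : gauss w g ≤ addVal (w (g.coeff i)) :=
  le_gauss_iff.1 le_rfl i

theorem gauss_zero : gauss w (0 : k[X]) = ⊤ := by simp [gauss]

theorem gauss_ne_top {g : k[X]} (hg : g ≠ 0) : gauss w g ≠ ⊤ := by
  intro h
  have hlead := gauss_le_coeff (w := w) g g.natDegree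
  rw [h, top_le_iff, addVal_eq_top_iff, map_eq_zero] at hlead
  exact hg (leadingCoeff_eq_zero.1 hlead)

theorem min_gauss_le (g h : k[X]) : min (gauss w g) (gauss w h) ≤ gauss w (g + h) :=
  le_gauss_iff.2 fun i => by
    rw [coeff_add]
    exact (min_le_min (gauss_le_coeff g i) (gauss_le_coeff h i)).trans
      ((addValuation w).map_add _ _)

theorem gauss_add_le_mul (g h : k[X]) : gauss w g + gauss w h ≤ gauss w (g * h) :=
  le_gauss_iff.2 fun i => by
    rw [coeff_mul]
    refine (addValuation w).map_le_sum fun p _ => ?_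
    rw [AddValuation.map_mul]
    exact add_le_add (gauss_le_coeff g _) (gauss_le_coeff h _)

theorem gauss_le_zero_of_monic {g : k[X]} (hg : g.Monic) : gauss w g ≤ 0 := by
  simpa [hg.coeff_natDegree, addVal_one] using gauss_le_coeff (w := w) g g.natDegree

end Gauss

namespace RatVal

variable {k : Type*} [Field k] {w : Valuation k ℤᵐ⁰} (μ : RatVal w) {f g h : k[X]}

/-- The restriction of `μ` to polynomials; its underlying function is `μ.pval`. -/
def polyVal : AddValuation k[X] (WithTop ℚ) := μ.val.comap (algebraMap k[X] (RatFunc k))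

theorem polyVal_apply (g : k[X]) : μ.polyVal g = μ.pval g := rfl

theorem pval_eq_top_iff : μ.pval g = ⊤ ↔ g = 0 := by
  rw [pval, AddValuation.top_iff, map_eq_zero_iff _ (RatFunc.algebraMap_injective k)]

theorem pval_ne_top (hg : g ≠ 0) : μ.pval g ≠ ⊤ := mt μ.pval_eq_top_iff.1 hg

theorem pval_eq_coe (hg : g ≠ 0) : μ.pval g = (μ.qval g : ℚ) := by
  obtain ⟨a, ha⟩ := WithTop.ne_top_iff_exists.1 (μ.pval_ne_top hg)
  rw [qval, ← ha, WithTop.untopD_coe]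

theorem pval_pow (g : k[X]) (n : ℕ) : μ.pval (g ^ n) = n • μ.pval g :=
  μ.polyVal.map_pow g n

theorem pval_C (a : k) : μ.pval (C a) = addVal (w a) := by
  rw [← μ.extends_base, pval, RatFunc.algebraMap_C]

theorem pval_X_nonneg : 0 ≤ μ.pval (X : k[X]) := by
  rw [pval, RatFunc.algebraMap_X]
  exact μ.nonneg_X

theorem qval_mul (hg : g ≠ 0) (hh : h ≠ 0) : μ.qval (g * h) = μ.qval g + μ.qval h := by
  have hval := μ.pval_mul g h
  rw [μ.pval_eq_coe hg, μ.pval_eq_coe hh, μ.pval_eq_coe (mul_ne_zero hg hh)] at hval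
  exact_mod_cast hval

theorem qval_pow (hg : g ≠ 0) (n : ℕ) : μ.qval (g ^ n) = n * μ.qval g := by
  have hval := μ.pval_pow g n
  rw [μ.pval_eq_coe hg, μ.pval_eq_coe (pow_ne_zero n hg), ← WithTop.coe_nsmul] at hval
  simpa using WithTop.coe_injective hval

theorem pval_sub (g h : k[X]) : min (μ.pval g) (μ.pval h) ≤ μ.pval (g - h) :=
  μ.polyVal.map_sub g h

theorem pval_sub_comm (g h : k[X]) : μ.pval (g - h) = μ.pval (h - g) :=
  μ.polyVal.map_sub_swap g h

theorem pval_eq_of_lt_sub (hgh : μ.pval g < μ.pval (g - h)) : μ.pval h = μ.pval g :=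
  μ.polyVal.map_eq_of_lt_sub (hgh.trans_eq (μ.pval_sub_comm g h))

theorem gauss_le_pval (g : k[X]) : gauss w g ≤ μ.pval g := by
  conv_rhs => rw [g.as_sum_support_C_mul_X_pow]
  refine μ.polyVal.map_le_sum fun i _ => ?_
  rw [polyVal_apply, pval_mul, pval_C, pval_pow]
  exact (gauss_le_coeff g i).trans (le_add_of_nonneg_right (nsmul_nonneg μ.pval_X_nonneg i))

/-! ### Homogeneous elements of the graded algebra -/

theorem mem_P_iff {α : ℚ} : g ∈ μ.P α ↔ (α : WithTop ℚ) ≤ μ.pval g := Iff.rfl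

theorem of_cls_congr {α β : ℚ} (hαβ : α = β) (g : μ.P α) (h : μ.P β) (hgh : g.1 = h.1) :
    DirectSum.of μ.Piece α (μ.cls g) = DirectSum.of μ.Piece β (μ.cls h) := by
  subst hαβ
  rw [Subtype.ext hgh]

theorem of_cls_eq_iff {α : ℚ} (g h : μ.P α) :
    DirectSum.of μ.Piece α (μ.cls g) = DirectSum.of μ.Piece α (μ.cls h) ↔
      (α : WithTop ℚ) < μ.pval (g.1 - h.1) := by
  rw [(DirectSum.of_injective α).eq_iff, cls_eq_cls]

theorem of_cls_eq_zero_iff {α : ℚ} (g : μ.P α) :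
    DirectSum.of μ.Piece α (μ.cls g) = 0 ↔ (α : WithTop ℚ) < μ.pval g.1 := by
  simpa [cls_zero] using μ.of_cls_eq_iff g 0

theorem H_zero : μ.H 0 = 0 := by
  rw [H, of_cls_eq_zero_iff]
  simp [pval_zero]

theorem H_ne_zero (hg : g ≠ 0) : μ.H g ≠ 0 := by
  rw [H, Ne, of_cls_eq_zero_iff, μ.pval_eq_coe hg]
  exact lt_irrefl _

theorem H_eq_of_cls {α : ℚ} (hα : μ.pval g = α) :
    μ.H g = DirectSum.of μ.Piece α (μ.cls ⟨g, hα.ge⟩) :=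
  μ.of_cls_congr (by rw [qval, hα, WithTop.untopD_coe]) _ _ rfl

theorem H_mul (g h : k[X]) : μ.H (g * h) = μ.H g * μ.H h := by
  by_cases hg : g = 0
  · simp [hg, H_zero]
  by_cases hh : h = 0
  · simp [hh, H_zero]
  rw [H, H, H, DirectSum.of_mul_of]
  exact μ.of_cls_congr (μ.qval_mul hg hh) _ (μ.pmul _ _) rfl

theorem H_one : μ.H 1 = 1 := μ.H_eq_of_cls (α := 0) μ.pval_one

theorem H_pow (g : k[X]) (n : ℕ) : μ.H (g ^ n) = μ.H g ^ n := by
  induction n with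
  | zero => simp [H_one]
  | succ n ih => rw [pow_succ, pow_succ, H_mul, ih]

theorem qval_eq_of_H_eq (hg : g ≠ 0) (hgh : μ.H g = μ.H h) : μ.qval g = μ.qval h := by
  by_contra hne
  have hcomp : μ.H g (μ.qval g) = 0 := by
    rw [hgh]
    exact DirectSum.of_eq_of_ne _ _ _ hne
  rw [H, DirectSum.of_eq_same] at hcomp
  exact μ.H_ne_zero hg (by rw [H, hcomp, map_zero])

theorem equivalent_iff (hg : g ≠ 0) : μ.Equivalent g h ↔ μ.pval g < μ.pval (g - h) := by
  rw [Equivalent, μ.pval_eq_coe hg, H]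
  constructor
  · intro hgh
    have hh : h ≠ 0 := by
      rintro rfl
      exact μ.H_ne_zero hg (hgh.trans μ.H_zero)
    have hval : μ.pval h = μ.qval g := by rw [μ.qval_eq_of_H_eq hg hgh, μ.pval_eq_coe hh]
    rwa [μ.H_eq_of_cls hval, of_cls_eq_iff] at hgh
  · intro hgh
    have hval : μ.pval h = μ.qval g := by
      rw [← μ.pval_eq_coe hg] at hgh ⊢
      exact μ.pval_eq_of_lt_sub hgh
    rwa [μ.H_eq_of_cls hval, of_cls_eq_iff]

theorem gmul_zero {α β : ℚ} (a : μ.Piece α) : μ.gmul a (0 : μ.Piece β) = 0 :=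
  DirectSum.GNonUnitalNonAssocSemiring.mul_zero (A := μ.Piece) a

theorem gmul_add {α β : ℚ} (a : μ.Piece α) (b c : μ.Piece β) :
    μ.gmul a (b + c) = μ.gmul a b + μ.gmul a c :=
  DirectSum.GNonUnitalNonAssocSemiring.mul_add (A := μ.Piece) a b c

theorem of_mul_apply_add {α : ℚ} (a : μ.Piece α) (z : μ.Gr) (β : ℚ) :
    (DirectSum.of μ.Piece α a * z) (α + β) = μ.gmul a (z β) := by
  induction z using DirectSum.induction_on with
  | zero => rw [mul_zero, DirectSum.zero_apply, DirectSum.zero_apply, gmul_zero]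
  | of γ c =>
    rw [DirectSum.of_mul_of]
    obtain rfl | h := eq_or_ne γ β
    · rw [DirectSum.of_eq_same, DirectSum.of_eq_same]
      rfl
    · rw [DirectSum.of_eq_of_ne _ _ _ (fun e => h (add_left_cancel e).symm),
        DirectSum.of_eq_of_ne _ _ _ h.symm, gmul_zero]
  | add x y hx hy =>
    rw [mul_add, DirectSum.add_apply, hx, hy, DirectSum.add_apply, gmul_add]

theorem H_dvd_of_cls_iff {α : ℚ} (g : μ.P α) :
    μ.H f ∣ DirectSum.of μ.Piece α (μ.cls g) ↔ ∃ h, (α : WithTop ℚ) < μ.pval (g.1 - f * h) := by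
  constructor
  · rintro ⟨z, hz⟩
    obtain ⟨β, rfl⟩ : ∃ β, α = μ.qval f + β := ⟨α - μ.qval f, by ring⟩
    obtain ⟨h, hh⟩ := μ.cls_surjective (z β)
    have hcomp : (DirectSum.of μ.Piece _ (μ.cls g)) (μ.qval f + β) =
        (μ.H f * z) (μ.qval f + β) := congrArg (fun x : μ.Gr => x (μ.qval f + β)) hz
    rw [H, DirectSum.of_eq_same, of_mul_apply_add, ← hh, gmul_cls, cls_eq_cls] at hcomp
    exact ⟨h.1, hcomp⟩
  · rintro ⟨h, hlt⟩
    have hfh : (α : WithTop ℚ) ≤ μ.pval (f * h) := by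
      simpa using (le_min g.2 hlt.le).trans (μ.pval_sub g.1 (g.1 - f * h))
    rw [(μ.of_cls_eq_iff g ⟨f * h, hfh⟩).2 hlt]
    obtain heq | hgt := hfh.eq_or_lt
    · rw [← μ.H_eq_of_cls heq.symm, H_mul]
      exact dvd_mul_right _ _
    · rw [(μ.of_cls_eq_zero_iff ⟨f * h, hfh⟩).2 hgt]
      exact dvd_zero _

theorem divides_iff (hg : g ≠ 0) : μ.Divides f g ↔ ∃ h, μ.pval g < μ.pval (g - f * h) := by
  rw [μ.pval_eq_coe hg]
  exact μ.H_dvd_of_cls_iff ⟨g, μ.self_mem_P g⟩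

theorem mem_residualIdeal_iff (g : μ.P 0) :
    μ.cls g ∈ μ.residualIdeal f ↔ ∃ h, 0 < μ.pval (g.1 - f * h) := by
  rw [residualIdeal, Ideal.mem_comap, Ideal.mem_span_singleton]
  exact μ.H_dvd_of_cls_iff g

theorem divides_zero (f : k[X]) : μ.Divides f 0 := by
  rw [Divides, H_zero]
  exact dvd_zero _

theorem divides_self (f : k[X]) : μ.Divides f f := dvd_rfl

theorem Divides.trans_dvd (hfg : μ.Divides f g) (hgh : g ∣ h) : μ.Divides f h := by
  obtain ⟨r, rfl⟩ := hgh
  rw [Divides, H_mul]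
  exact hfg.mul_right _

end RatVal

section Expansion

variable {k : Type*} [Field k] {φ : k[X]}

theorem expCoeff_zero (φ g : k[X]) : expCoeff φ g 0 = g %ₘ φ := rfl

theorem expCoeff_succ (φ g : k[X]) (s : ℕ) :
    expCoeff φ g (s + 1) = expCoeff φ (g /ₘ φ) s := by
  simp only [expCoeff, Function.iterate_succ_apply]

theorem expCoeff_degree_lt (hφ : φ.Monic) (g : k[X]) (s : ℕ) :
    (expCoeff φ g s).degree < φ.degree :=
  degree_modByMonic_lt _ hφ

theorem natDegree_lt_of_degree_lt (hd : 0 < φ.natDegree) {a : k[X]} (h : a.degree < φ.degree) :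
    a.natDegree < φ.natDegree := by
  by_cases ha : a = 0
  · simpa [ha] using hd
  · exact natDegree_lt_natDegree ha h

theorem add_mul_modByMonic (hφ : φ.Monic) {a : k[X]} (ha : a.degree < φ.degree) (g : k[X]) :
    (a + φ * g) %ₘ φ = a :=
  (div_modByMonic_unique g a hφ ⟨rfl, ha⟩).2

theorem add_mul_divByMonic (hφ : φ.Monic) {a : k[X]} (ha : a.degree < φ.degree) (g : k[X]) :
    (a + φ * g) /ₘ φ = g :=
  (div_modByMonic_unique g a hφ ⟨rfl, ha⟩).1

theorem expansion_induction (hφ : φ.Monic) (hd : 0 < φ.natDegree) {P : k[X] → Prop} (zero : P 0)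
    (add_mul : ∀ a g, a.degree < φ.degree → P g → P (a + φ * g)) (g : k[X]) : P g := by
  induction g using degree_lt_wf.induction with | _ g ih =>
  by_cases hg : g = 0
  · rwa [hg]
  · rw [← modByMonic_add_div g φ]
    exact add_mul _ _ (degree_modByMonic_lt g hφ)
      (ih _ (degree_divByMonic_lt g φ hg (natDegree_pos_iff_degree_pos.1 hd)))

theorem expCoeff_eq_zero (hφ : φ.Monic) {g : k[X]} {s : ℕ}
    (hg : g.natDegree < s * φ.natDegree) : expCoeff φ g s = 0 := by
  induction s generalizing g with
  | zero => simp at hg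
  | succ s ih =>
    rw [expCoeff_succ]
    by_cases hlt : g.natDegree < φ.natDegree
    · rw [(divByMonic_eq_zero_iff hφ).2 (degree_lt_degree hlt), expCoeff,
        Function.iterate_fixed (zero_divByMonic φ), zero_modByMonic]
    · refine ih ?_
      rw [natDegree_divByMonic _ hφ]
      rw [Nat.add_mul] at hg
      omega

theorem exists_leading_expCoeff (hφ : φ.Monic) (hd : 0 < φ.natDegree) {g : k[X]} (hg : g.Monic) :
    ∃ s : ℕ, (expCoeff φ g s).Monic ∧
      g.natDegree = (expCoeff φ g s).natDegree + s * φ.natDegree := by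
  induction g using expansion_induction hφ hd with
  | zero => exact absurd rfl hg.ne_zero
  | add_mul a g ha ih =>
    by_cases h0 : g = 0
    · refine ⟨0, ?_⟩
      rw [expCoeff_zero, add_mul_modByMonic hφ ha]
      simpa [h0] using hg
    · have hdeg : a.degree < (φ * g).degree :=
        ha.trans_le (degree_le_mul_left φ h0)
      have hgm : g.Monic := by
        rw [Monic, leadingCoeff_add_of_degree_lt hdeg, leadingCoeff_monic_mul hφ] at hg
        exact hg
      obtain ⟨s, hs, hs'⟩ := ih hgm
      refine ⟨s + 1, ?_⟩
      rw [expCoeff_succ, add_mul_divByMonic hφ ha, natDegree_add_eq_right_of_degree_lt hdeg,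
        hφ.natDegree_mul hgm, hs']
      exact ⟨hs, by ring⟩

end Expansion

section AugmentedValue

variable {k : Type*} [Field k] {Γ₀ : Type*} [LinearOrderedAddCommMonoidWithTop Γ₀]

/-- The augmented value `min_s (ν(a_s) + s δ)` of `g`, where `g = ∑ a_s φ^s` is the `φ`-expansion.
The parameter `δ` is the augmented value of `φ` itself, so that `[μ; (φ, λ)]` is the case
`δ = μ(φ) + λ`. -/
def augVal (ν : AddValuation k[X] Γ₀) (φ : k[X]) (δ : Γ₀) (g : k[X]) : Γ₀ :=
  (Finset.range (g.natDegree + 1)).inf fun s => ν (expCoeff φ g s) + s • δ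

variable {ν : AddValuation k[X] Γ₀} {φ : k[X]} {δ : Γ₀}

theorem le_augVal_add_iff (hφ : φ.Monic) (hd : 0 < φ.natDegree) {T c : Γ₀} {g : k[X]} :
    T ≤ augVal ν φ δ g + c ↔ ∀ s : ℕ, T ≤ ν (expCoeff φ g s) + s • δ + c := by
  rw [augVal, Finset.apply_inf_eq_inf_comp_of_linearOrder (· + c) add_left_mono (top_add c),
    Finset.le_inf_iff]
  refine ⟨fun h s => ?_, fun h s _ => h s⟩
  by_cases hs : s ∈ Finset.range (g.natDegree + 1)
  · exact h s hs
  · have hlt : g.natDegree < s * φ.natDegree :=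
      (not_lt.1 (mt Finset.mem_range.2 hs)).trans (Nat.le_mul_of_pos_right s hd)
    rw [expCoeff_eq_zero hφ hlt, ν.map_zero, top_add, top_add]
    exact le_top

theorem le_augVal_iff (hφ : φ.Monic) (hd : 0 < φ.natDegree) {T : Γ₀} {g : k[X]} :
    T ≤ augVal ν φ δ g ↔ ∀ s : ℕ, T ≤ ν (expCoeff φ g s) + s • δ := by
  simpa only [add_zero] using le_augVal_add_iff (ν := ν) (δ := δ) (c := 0) hφ hd (T := T) (g := g)

theorem augVal_le (hφ : φ.Monic) (hd : 0 < φ.natDegree) (g : k[X]) (s : ℕ) :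
    augVal ν φ δ g ≤ ν (expCoeff φ g s) + s • δ :=
  (le_augVal_iff hφ hd).1 le_rfl s

theorem augVal_le_mod (hφ : φ.Monic) (hd : 0 < φ.natDegree) (g : k[X]) :
    augVal ν φ δ g ≤ ν (g %ₘ φ) := by
  simpa [expCoeff_zero] using augVal_le (ν := ν) (δ := δ) hφ hd g 0

theorem augVal_zero : augVal ν φ δ 0 = ⊤ := by
  simp [augVal, expCoeff]

theorem augVal_add_mul (hφ : φ.Monic) (hd : 0 < φ.natDegree) {a : k[X]}
    (ha : a.degree < φ.degree) (g : k[X]) :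
    augVal ν φ δ (a + φ * g) = min (ν a) (augVal ν φ δ g + δ) := by
  refine eq_of_forall_le_iff fun T => ?_
  rw [le_min_iff, le_augVal_iff hφ hd, le_augVal_add_iff hφ hd, ← Nat.and_forall_add_one]
  simp only [expCoeff_zero, expCoeff_succ, add_mul_modByMonic hφ ha, add_mul_divByMonic hφ ha,
    zero_smul, add_zero, succ_nsmul, add_assoc]

theorem augVal_of_degree_lt (hφ : φ.Monic) (hd : 0 < φ.natDegree) {a : k[X]}
    (ha : a.degree < φ.degree) : augVal ν φ δ a = ν a := by
  simpa [augVal_zero] using augVal_add_mul (ν := ν) (δ := δ) hφ hd ha 0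

theorem augVal_mul_left (hφ : φ.Monic) (hd : 0 < φ.natDegree) (g : k[X]) :
    augVal ν φ δ (φ * g) = augVal ν φ δ g + δ := by
  have hbot : (0 : k[X]).degree < φ.degree := by
    rw [degree_zero, bot_lt_iff_ne_bot, Ne, degree_eq_bot]
    exact hφ.ne_zero
  simpa using augVal_add_mul (ν := ν) (δ := δ) hφ hd hbot g

theorem augVal_pow_mul (hφ : φ.Monic) (hd : 0 < φ.natDegree) (n : ℕ) (g : k[X]) :
    augVal ν φ δ (φ ^ n * g) = augVal ν φ δ g + n • δ := by
  induction n with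
  | zero => simp
  | succ n ih => rw [pow_succ', mul_assoc, augVal_mul_left hφ hd, ih, add_assoc, succ_nsmul]

theorem min_augVal_le (hφ : φ.Monic) (hd : 0 < φ.natDegree) (g h : k[X]) :
    min (augVal ν φ δ g) (augVal ν φ δ h) ≤ augVal ν φ δ (g + h) := by
  induction g using expansion_induction hφ hd generalizing h with
  | zero => simp
  | add_mul a g ha ih =>
    have hb : (h %ₘ φ).degree < φ.degree := degree_modByMonic_lt h hφ
    rw [← modByMonic_add_div h φ]
    rw [show a + φ * g + (h %ₘ φ + φ * (h /ₘ φ)) = (a + h %ₘ φ) + φ * (g + h /ₘ φ) by ring,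
      augVal_add_mul hφ hd ha, augVal_add_mul hφ hd hb,
      augVal_add_mul hφ hd ((degree_add_le _ _).trans_lt (max_lt ha hb))]
    refine le_min ?_ ?_
    · exact (min_le_min (min_le_left _ _) (min_le_left _ _)).trans (ν.map_add a _)
    · refine (min_le_min (min_le_right _ _) (min_le_right _ _)).trans ?_
      rw [min_add_add_right]
      exact add_le_add_left (ih _) _

theorem augVal_neg (hφ : φ.Monic) (hd : 0 < φ.natDegree) (g : k[X]) :
    augVal ν φ δ (-g) = augVal ν φ δ g := by
  induction g using expansion_induction hφ hd with
  | zero => simp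
  | add_mul a g ha ih =>
    rw [show -(a + φ * g) = -a + φ * (-g) by ring, augVal_add_mul hφ hd ha,
      augVal_add_mul hφ hd (by rwa [degree_neg]), ih, ν.map_neg]

theorem augVal_mono (hφ : φ.Monic) (hd : 0 < φ.natDegree) {δ' : Γ₀} (h : δ ≤ δ') (g : k[X]) :
    augVal ν φ δ g ≤ augVal ν φ δ' g :=
  (le_augVal_iff hφ hd).2 fun s =>
    (augVal_le hφ hd g s).trans (add_le_add_right (nsmul_le_nsmul_right h s) _)

theorem augVal_add_le {l : Γ₀} (hl : 0 ≤ l) (g : k[X]) :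
    augVal ν φ (δ + l) g ≤ augVal ν φ δ g + g.natDegree • l := by
  conv_rhs => rw [augVal, Finset.apply_inf_eq_inf_comp_of_linearOrder (· + g.natDegree • l)
    add_left_mono (top_add _)]
  refine Finset.le_inf fun s hs => (Finset.inf_le hs).trans ?_
  rw [nsmul_add, ← add_assoc]
  exact add_le_add_right (nsmul_le_nsmul_left hl (Nat.lt_succ_iff.1 (Finset.mem_range.1 hs))) _

theorem val_add_augVal_le_augVal_mul (hφ : φ.Monic) (hd : 0 < φ.natDegree)
    (hle : ∀ g, ν g ≤ augVal ν φ δ g) (f g : k[X]) :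
    ν f + augVal ν φ δ g ≤ augVal ν φ δ (f * g) := by
  induction g using expansion_induction hφ hd with
  | zero => simp [augVal_zero]
  | add_mul a g ha ih =>
    rw [augVal_add_mul hφ hd ha, show f * (a + φ * g) = f * a + φ * (f * g) by ring]
    refine le_trans (le_min ?_ ?_) (min_augVal_le hφ hd _ _)
    · refine (add_le_add_right (min_le_left _ _) _).trans ?_
      rw [← ν.map_mul]
      exact hle _
    · refine (add_le_add_right (min_le_right _ _) _).trans ?_
      rw [augVal_mul_left hφ hd, ← add_assoc]
      exact add_le_add_left ih _

theorem augVal_add_le_augVal_mul (hφ : φ.Monic) (hd : 0 < φ.natDegree)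
    (hle : ∀ g, ν g ≤ augVal ν φ δ g) (g h : k[X]) :
    augVal ν φ δ g + augVal ν φ δ h ≤ augVal ν φ δ (g * h) := by
  induction g using expansion_induction hφ hd with
  | zero => simp [augVal_zero]
  | add_mul a g ha ih =>
    rw [augVal_add_mul hφ hd ha, show (a + φ * g) * h = a * h + φ * (g * h) by ring]
    refine le_trans (le_min ?_ ?_) (min_augVal_le hφ hd _ _)
    · exact (add_le_add_left (min_le_left _ _) _).trans
        (val_add_augVal_le_augVal_mul hφ hd hle a h)
    · refine (add_le_add_left (min_le_right _ _) _).trans ?_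
      rw [augVal_mul_left hφ hd, add_right_comm]
      exact add_le_add_left ih _

/-- Up to terms of larger augmented value, `g` is `φ^i g'`, where `i` is the smallest exponent at
which the minimum defining the augmented value is attained. -/
theorem exists_initial_augVal (hφ : φ.Monic) (hd : 0 < φ.natDegree) (hδ : δ ≠ ⊤) {g : k[X]}
    (hg : augVal ν φ δ g ≠ ⊤) : ∃ (i : ℕ) (g' : k[X]),
      augVal ν φ δ g < augVal ν φ δ (g - φ ^ i * g') ∧
      augVal ν φ δ (φ ^ i * g') = augVal ν φ δ g ∧
      ν (g' %ₘ φ) = augVal ν φ δ g' := by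
  induction g using expansion_induction hφ hd with
  | zero => exact absurd augVal_zero hg
  | add_mul a g ha ih =>
    rcases le_or_gt (ν a) (augVal ν φ δ g + δ) with hle | hlt
    · refine ⟨0, a + φ * g, ?_, by simp, ?_⟩
      · simpa [augVal_zero] using hg.lt_top
      · rw [add_mul_modByMonic hφ ha g, augVal_add_mul hφ hd ha, min_eq_left hle]
    · have hmin : augVal ν φ δ (a + φ * g) = augVal ν φ δ g + δ := by
        rw [augVal_add_mul hφ hd ha, min_eq_right hlt.le]
      have hg' : augVal ν φ δ g ≠ ⊤ := fun h => hg (by rw [hmin, h, top_add])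
      obtain ⟨i, g', hsub, heq, hmod⟩ := ih hg'
      refine ⟨i + 1, g', ?_, ?_, hmod⟩
      · rw [hmin, show a + φ * g - φ ^ (i + 1) * g' = a + φ * (g - φ ^ i * g') by ring,
          augVal_add_mul hφ hd ha]
        exact lt_min hlt ((add_lt_add_iff_left_of_ne_top hδ).2 hsub)
      · rw [hmin, pow_succ', mul_assoc, augVal_mul_left hφ hd, heq]

end AugmentedValue

namespace RatVal

variable {k : Type*} [Field k] {w : Valuation k ℤᵐ⁰} {μ : RatVal w} {φ g h : k[X]}
  {δ : WithTop ℚ}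

/-! ### Minimal and key polynomials -/

theorem IsMinimal.not_divides (hφ : μ.IsMinimal φ) {a : k[X]} (ha : a ≠ 0)
    (hd : a.degree < φ.degree) : ¬ μ.Divides φ a :=
  hφ.2 a ha (natDegree_lt_of_degree_lt hφ.1 hd)

theorem IsMinimal.pval_add_mul (hφ : μ.IsMinimal φ) {a : k[X]} (ha : a.degree < φ.degree)
    (g : k[X]) : μ.pval (a + φ * g) = min (μ.pval a) (μ.pval (φ * g)) := by
  refine le_antisymm ?_ (μ.pval_add _ _)
  by_cases h0 : a = 0
  · simp [h0, pval_zero]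
  have hle : μ.pval (a + φ * g) ≤ μ.pval a := by
    by_contra! hlt
    exact hφ.not_divides h0 ha ((μ.divides_iff h0).2 ⟨-g, by simpa using hlt⟩)
  refine le_min hle ?_
  simpa [hle] using μ.pval_sub (a + φ * g) a

theorem pval_eq_augVal (hm : φ.Monic) (hφ : μ.IsMinimal φ) (g : k[X]) :
    μ.pval g = augVal μ.polyVal φ (μ.pval φ) g := by
  induction g using expansion_induction hm hφ.1 with
  | zero => rw [pval_zero, augVal_zero]
  | add_mul a g ha ih =>
    rw [augVal_add_mul hm hφ.1 ha, hφ.pval_add_mul ha, pval_mul, ih, add_comm (μ.pval φ),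
      polyVal_apply]

theorem pval_le_augVal (hm : φ.Monic) (hφ : μ.IsMinimal φ) (hδ : μ.pval φ ≤ δ) (g : k[X]) :
    μ.pval g ≤ augVal μ.polyVal φ δ g :=
  (pval_eq_augVal hm hφ g).trans_le (augVal_mono hm hφ.1 hδ g)

theorem augVal_ne_top (hm : φ.Monic) (hd : 0 < φ.natDegree) (hδ : δ ≠ ⊤) (hg : g ≠ 0) :
    augVal μ.polyVal φ δ g ≠ ⊤ := by
  induction g using expansion_induction hm hd with
  | zero => exact absurd rfl hg
  | add_mul a g ha ih =>
    rw [augVal_add_mul hm hd ha, Ne, min_eq_top, WithTop.add_eq_top, polyVal_apply,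
      pval_eq_top_iff]
    rintro ⟨rfl, h⟩
    exact h.elim (ih (right_ne_zero_of_mul (by simpa using hg))) hδ

theorem pval_le_pval_mod (hm : φ.Monic) (hφ : μ.IsMinimal φ) (g : k[X]) :
    μ.pval g ≤ μ.pval (g %ₘ φ) :=
  (pval_eq_augVal hm hφ g).trans_le (augVal_le_mod hm hφ.1 g)

theorem pval_mod_eq (hm : φ.Monic) (hφ : μ.IsMinimal φ) (hg : ¬ μ.Divides φ g) :
    μ.pval (g %ₘ φ) = μ.pval g := by
  have h0 : g ≠ 0 := fun h => hg (h ▸ μ.divides_zero φ)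
  rw [divides_iff μ h0] at hg
  push Not at hg
  refine le_antisymm ?_ (pval_le_pval_mod hm hφ g)
  rw [modByMonic_eq_sub_mul_div g]
  exact hg (g /ₘ φ)

theorem IsKey.monic (hφ : μ.IsKey φ) : φ.Monic := hφ.1

theorem IsKey.isMinimal (hφ : μ.IsKey φ) : μ.IsMinimal φ := hφ.2.1

theorem IsKey.natDegree_pos (hφ : μ.IsKey φ) : 0 < φ.natDegree := hφ.2.1.1

theorem IsKey.divides_or_divides (hφ : μ.IsKey φ) (hgh : μ.Divides φ (g * h)) :
    μ.Divides φ g ∨ μ.Divides φ h := by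
  rw [Divides, H_mul, ← Ideal.mem_span_singleton] at hgh
  exact (hφ.2.2.2.mem_or_mem hgh).imp Ideal.mem_span_singleton.1 Ideal.mem_span_singleton.1

theorem IsKey.divides_of_divides_pow (hφ : μ.IsKey φ) {n : ℕ} (hg : μ.Divides φ (g ^ n)) :
    μ.Divides φ g := by
  rw [Divides, H_pow, ← Ideal.mem_span_singleton] at hg
  exact Ideal.mem_span_singleton.1 (hφ.2.2.2.mem_of_pow_mem n hg)

theorem IsKey.irreducible (hφ : μ.IsKey φ) : Irreducible φ := by
  rw [hφ.monic.irreducible_iff_natDegree]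
  refine ⟨?_, fun f g hf hg hfg => ?_⟩
  · rintro rfl
    simpa using hφ.natDegree_pos
  · by_contra! hpos
    have hdeg : φ.natDegree = f.natDegree + g.natDegree := by rw [← hfg, hf.natDegree_mul hg]
    have hdvd : μ.Divides φ (f * g) := hfg.symm ▸ μ.divides_self φ
    rcases hφ.divides_or_divides hdvd with hf' | hg'
    · exact hφ.isMinimal.2 f hf.ne_zero (by omega) hf'
    · exact hφ.isMinimal.2 g hg.ne_zero (by omega) hg'

/-! ### Augmented valuations -/

theorem IsKey.augVal_mul_le (hφ : μ.IsKey φ) (hg : μ.pval (g %ₘ φ) = augVal μ.polyVal φ δ g)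
    (hh : μ.pval (h %ₘ φ) = augVal μ.polyVal φ δ h) :
    augVal μ.polyVal φ δ (g * h) ≤ augVal μ.polyVal φ δ g + augVal μ.polyVal φ δ h := by
  rw [← hg, ← hh]
  by_cases hg0 : g %ₘ φ = 0
  · simp [hg0, pval_zero]
  by_cases hh0 : h %ₘ φ = 0
  · simp [hh0, pval_zero]
  refine (augVal_le_mod hφ.monic hφ.natDegree_pos _).trans ?_
  rw [mul_modByMonic, polyVal_apply, pval_mod_eq hφ.monic hφ.isMinimal, pval_mul]
  intro hdvd
  exact (hφ.divides_or_divides hdvd).elim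
    (hφ.isMinimal.not_divides hg0 (degree_modByMonic_lt _ hφ.monic))
    (hφ.isMinimal.not_divides hh0 (degree_modByMonic_lt _ hφ.monic))

theorem IsKey.augVal_mul (hφ : μ.IsKey φ) (hδ : μ.pval φ ≤ δ) (hδ' : δ ≠ ⊤) (g h : k[X]) :
    augVal μ.polyVal φ δ (g * h) = augVal μ.polyVal φ δ g + augVal μ.polyVal φ δ h := by
  have hm := hφ.monic
  have hd := hφ.natDegree_pos
  by_cases hg : g = 0
  · simp [hg, augVal_zero]
  by_cases hh : h = 0
  · simp [hh, augVal_zero]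
  have hgt := augVal_ne_top (μ := μ) hm hd hδ' hg
  have hht := augVal_ne_top (μ := μ) hm hd hδ' hh
  have supermul := augVal_add_le_augVal_mul (ν := μ.polyVal) (δ := δ) hm hd
    (pval_le_augVal hm hφ.isMinimal hδ)
  obtain ⟨i, g', hg_sub, hg_eq, hg_mod⟩ := exists_initial_augVal hm hd hδ' hgt
  obtain ⟨j, h', hh_sub, hh_eq, hh_mod⟩ := exists_initial_augVal hm hd hδ' hht
  have initial_le : augVal μ.polyVal φ δ (φ ^ i * g' * (φ ^ j * h')) ≤
      augVal μ.polyVal φ δ g + augVal μ.polyVal φ δ h := by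
    rw [← hg_eq, ← hh_eq, show φ ^ i * g' * (φ ^ j * h') = φ ^ i * (φ ^ j * (g' * h')) by ring]
    simp only [augVal_pow_mul hm hd]
    rw [add_add_add_comm, add_assoc, add_comm (j • δ)]
    exact add_le_add_left (hφ.augVal_mul_le hg_mod hh_mod) _
  refine le_antisymm ?_ (supermul g h)
  by_contra! hlt
  refine initial_le.not_gt ?_
  rw [show φ ^ i * g' * (φ ^ j * h') =
    g * h + (-((g - φ ^ i * g') * h) + -(φ ^ i * g' * (h - φ ^ j * h'))) by ring]
  refine (lt_min hlt (lt_of_lt_of_le (lt_min ?_ ?_) (min_augVal_le hm hd _ _))).trans_le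
    (min_augVal_le hm hd _ _)
  · rw [augVal_neg hm hd]
    exact (WithTop.add_lt_add_right hht hg_sub).trans_le (supermul _ _)
  · rw [augVal_neg hm hd]
    refine (WithTop.add_lt_add_left hgt hh_sub).trans_le (le_trans ?_ (supermul _ _))
    rw [hg_eq]

/-- The augmented valuation on `k[x]` which takes the value `δ ≥ μ(φ)` on the key polynomial
`φ`. -/
def IsKey.augValuation (hφ : μ.IsKey φ) (hδ : μ.pval φ ≤ δ) (hδ' : δ ≠ ⊤) :
    AddValuation k[X] (WithTop ℚ) :=
  .of (augVal μ.polyVal φ δ) augVal_zero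
    ((augVal_of_degree_lt hφ.monic hφ.natDegree_pos
      (by simpa using natDegree_pos_iff_degree_pos.1 hφ.natDegree_pos)).trans μ.pval_one)
    (min_augVal_le hφ.monic hφ.natDegree_pos) (hφ.augVal_mul hδ hδ')

theorem IsKey.augValuation_apply (hφ : μ.IsKey φ) (hδ : μ.pval φ ≤ δ) (hδ' : δ ≠ ⊤) (g : k[X]) :
    hφ.augValuation hδ hδ' g = augVal μ.polyVal φ δ g := rfl

theorem isAugmentation_iff {l : ℚ} {μ' : RatVal w} :
    μ.IsAugmentation φ l μ' ↔ ∀ g, μ'.pval g = augVal μ.polyVal φ (μ.pval φ + l) g := by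
  have hterm (g : k[X]) (s : ℕ) : μ.pval (expCoeff φ g s * φ ^ s) + ((s * l : ℚ) : WithTop ℚ) =
      μ.polyVal (expCoeff φ g s) + s • (μ.pval φ + l) := by
    rw [pval_mul, pval_pow, nsmul_add, add_assoc, ← nsmul_eq_mul, WithTop.coe_nsmul,
      polyVal_apply]
  simp only [IsAugmentation, hterm, augVal]

theorem IsInductive.exists_pval_le (hμ : μ.IsInductive) :
    ∃ c : ℚ, 0 ≤ c ∧ ∀ g : k[X], μ.pval g ≤ gauss w g + g.natDegree • (c : WithTop ℚ) := by
  induction hμ with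
  | minimal μ h => exact ⟨0, le_rfl, fun g => by simp [h g]⟩
  | augment μ μ' φ l _ hφ hl h ih =>
    obtain ⟨c, hc, hle⟩ := ih
    refine ⟨c + l, by positivity, fun g => ?_⟩
    calc μ'.pval g = augVal μ.polyVal φ (μ.pval φ + l) g := isAugmentation_iff.1 h g
      _ ≤ μ.pval g + g.natDegree • (l : WithTop ℚ) := by
        rw [pval_eq_augVal hφ.monic hφ.isMinimal g]
        exact augVal_add_le (WithTop.coe_nonneg.2 hl.le) g
      _ ≤ gauss w g + g.natDegree • (c : WithTop ℚ) + g.natDegree • (l : WithTop ℚ) :=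
        add_le_add_left (hle g) _
      _ = _ := by rw [add_assoc, ← nsmul_add, WithTop.coe_add]

theorem natDegree_mul_qval_le_add {c : ℚ} (hc : 0 ≤ c)
    (hle : ∀ g : k[X], μ.pval g ≤ gauss w g + g.natDegree • (c : WithTop ℚ))
    (hm : φ.Monic) (hφ : μ.IsMinimal φ) (hg : g.Monic) :
    φ.natDegree * μ.qval g ≤
      g.natDegree * μ.qval φ + φ.natDegree * (c * φ.natDegree + |μ.qval φ|) := by
  obtain ⟨s, hs, hdeg⟩ := exists_leading_expCoeff hm hφ.1 hg
  set r := expCoeff φ g s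
  have hr : r.natDegree < φ.natDegree := natDegree_lt_of_degree_lt hφ.1 (expCoeff_degree_lt hm g s)
  have hg_le : μ.qval g ≤ μ.qval r + s * μ.qval φ := by
    have := (pval_eq_augVal hm hφ g).trans_le (augVal_le hm hφ.1 g s)
    rw [polyVal_apply, μ.pval_eq_coe hg.ne_zero, μ.pval_eq_coe hs.ne_zero,
      μ.pval_eq_coe hm.ne_zero, ← WithTop.coe_nsmul, nsmul_eq_mul] at this
    exact_mod_cast this
  have hr_le : μ.qval r ≤ r.natDegree * c := by
    have := (hle r).trans (add_le_add_left (gauss_le_zero_of_monic hs) _)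
    rw [zero_add, μ.pval_eq_coe hs.ne_zero, ← WithTop.coe_nsmul, nsmul_eq_mul] at this
    exact_mod_cast this
  have hdegQ : (g.natDegree : ℚ) = r.natDegree + s * φ.natDegree := by exact_mod_cast hdeg
  have hrQ : (r.natDegree : ℚ) ≤ φ.natDegree := by exact_mod_cast hr.le
  have hrc : r.natDegree * c ≤ c * φ.natDegree := by
    rw [mul_comm]
    exact mul_le_mul_of_nonneg_left hrQ hc
  have habs : -(φ.natDegree * |μ.qval φ|) ≤ r.natDegree * μ.qval φ := by
    rw [← mul_neg]
    nlinarith [neg_abs_le (μ.qval φ), abs_nonneg (μ.qval φ), Nat.cast_nonneg (α := ℚ) r.natDegree]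
  calc φ.natDegree * μ.qval g ≤ φ.natDegree * (c * φ.natDegree + s * μ.qval φ) := by
        gcongr
        linarith
    _ ≤ _ := by
        rw [hdegQ]
        linarith

theorem IsInductive.natDegree_mul_qval_le (hμ : μ.IsInductive) (hm : φ.Monic)
    (hφ : μ.IsMinimal φ) (hg : g.Monic) :
    φ.natDegree * μ.qval g ≤ g.natDegree * μ.qval φ := by
  obtain ⟨c, hc, hle⟩ := hμ.exists_pval_le
  set b := φ.natDegree * (c * φ.natDegree + |μ.qval φ|)
  -- Apply the bound to all powers of `g`: the error term does not depend on the power.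
  have hpow (N : ℕ) : N * (φ.natDegree * μ.qval g - g.natDegree * μ.qval φ) ≤ b := by
    have := natDegree_mul_qval_le_add hc hle hm hφ (hg.pow N)
    rw [μ.qval_pow hg.ne_zero, hg.natDegree_pow, Nat.cast_mul] at this
    linarith
  by_contra! hlt
  obtain ⟨N, hN⟩ := Archimedean.arch (b + 1) (sub_pos.2 hlt)
  rw [nsmul_eq_mul] at hN
  linarith [hpow N]

theorem IsMinimal.pval_sub_pow_mul_le (hφ : μ.IsMinimal φ) (hm : φ.Monic) {n : ℕ}
    (hg : g.natDegree < n * φ.natDegree) (h : k[X]) : μ.pval (g - φ ^ n * h) ≤ μ.pval g := by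
  induction n generalizing g with
  | zero => simp at hg
  | succ n ih =>
    by_cases hlt : g.natDegree < φ.natDegree
    · rw [show g - φ ^ (n + 1) * h = g + φ * (-(φ ^ n * h)) by ring,
        hφ.pval_add_mul (degree_lt_degree hlt)]
      exact min_le_left _ _
    · have hdiv : (g /ₘ φ).natDegree < n * φ.natDegree := by
        rw [natDegree_divByMonic _ hm]
        rw [Nat.add_mul] at hg
        omega
      have ha := degree_modByMonic_lt g hm
      rw [← modByMonic_add_div g φ,
        show g %ₘ φ + φ * (g /ₘ φ) - φ ^ (n + 1) * h =
          g %ₘ φ + φ * (g /ₘ φ - φ ^ n * h) by ring,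
        hφ.pval_add_mul ha, hφ.pval_add_mul ha, pval_mul, pval_mul]
      exact min_le_min le_rfl (add_le_add_right (ih hdiv) _)

theorem IsMinimal.of_equivalent_pow (hφ : μ.IsMinimal φ) (hm : φ.Monic) {f : k[X]} {n : ℕ}
    (hn : 0 < n) (hf : f.natDegree = n * φ.natDegree) (hequiv : μ.Equivalent f (φ ^ n)) :
    μ.IsMinimal f := by
  refine ⟨hf ▸ Nat.mul_pos hn hφ.1, fun g hg hlt hdvd => ?_⟩
  have hdvd' : μ.Divides (φ ^ n) g := by
    rw [Divides, ← show μ.H f = μ.H (φ ^ n) from hequiv]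
    exact hdvd
  obtain ⟨r, hr⟩ := (μ.divides_iff hg).1 hdvd'
  exact hr.not_ge (hφ.pval_sub_pow_mul_le hm (hf ▸ hlt) r)

end RatVal

theorem mem_pow_of_mul_pow_mem {R : Type*} [CommRing R] {I : Ideal R} {x s : R}
    {n : ℕ} (hs : s - 1 ∈ I) (hx : x * s ^ n ∈ I ^ n) : x ∈ I ^ n := by
  have hone : 1 - s ^ n ∈ I := by
    rw [← neg_sub, neg_mem_iff]
    exact I.mem_of_dvd (by simpa using sub_dvd_pow_sub_pow s 1 n) hs
  obtain ⟨t, ht⟩ := sub_dvd_pow_sub_pow 1 (1 - s ^ n) n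
  rw [one_pow, sub_sub_cancel] at ht
  rw [show x = x * s ^ n * t + (1 - s ^ n) ^ n * x by linear_combination x * ht]
  exact (I ^ n).add_mem (Ideal.mul_mem_right _ _ hx)
    (Ideal.mul_mem_right _ _ (Ideal.pow_mem_pow hone n))

namespace RatVal

variable {k : Type*} [Field k] {w : Valuation k ℤᵐ⁰} {μ : RatVal w} {φ : k[X]}

/-! ### Residual ideals of key polynomials -/

variable (μ) in
/-- The ring of polynomials of non-negative value, of which `Δ(μ)` is the quotient by the
polynomials of positive value. -/
def nonneg : Subring k[X] where
  __ := μ.P 0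
  one_mem' := μ.pval_one.ge
  mul_mem' {a b} (ha : 0 ≤ μ.pval a) (hb : 0 ≤ μ.pval b) :=
    (add_nonneg ha hb).trans_eq (μ.pval_mul a b).symm

variable (μ) in
/-- The reduction map from the polynomials of non-negative value onto `Δ(μ)`, as a ring
homomorphism; it allows computing in `Δ(μ)` with polynomials. -/
def reduction : μ.nonneg →+* μ.Delta where
  toFun g := μ.cls ⟨g.1, g.2⟩
  map_zero' := rfl
  map_one' := rfl
  map_add' _ _ := rfl
  map_mul' g h := by
    apply DirectSum.of_injective (β := μ.Piece) 0
    rw [DirectSum.of_zero_mul, DirectSum.of_mul_of]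
    exact μ.of_cls_congr (zero_add 0).symm _ (μ.pmul ⟨g.1, g.2⟩ ⟨h.1, h.2⟩) rfl

theorem reduction_surjective : Function.Surjective μ.reduction := fun x =>
  let ⟨g, hg⟩ := μ.cls_surjective x
  ⟨⟨g.1, g.2⟩, hg⟩

theorem reduction_eq_iff {g h : μ.nonneg} :
    μ.reduction g = μ.reduction h ↔ 0 < μ.pval (g.1 - h.1) :=
  μ.cls_eq_cls (α := 0) ⟨g.1, g.2⟩ ⟨h.1, h.2⟩

theorem reduction_mem_iff {f : k[X]} {g : μ.nonneg} :
    μ.reduction g ∈ μ.residualIdeal f ↔ ∃ h, 0 < μ.pval (g.1 - f * h) :=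
  μ.mem_residualIdeal_iff ⟨g.1, g.2⟩

theorem reduction_mem_of_dvd {f : k[X]} {g : μ.nonneg} (h : f ∣ g.1) :
    μ.reduction g ∈ μ.residualIdeal f := by
  obtain ⟨r, hr⟩ := h
  refine reduction_mem_iff.2 ⟨r, ?_⟩
  rw [← hr, sub_self, pval_zero]
  exact WithTop.coe_lt_top 0

theorem nonneg_of_pval_sub_pos {g h : k[X]} (hg : g ∈ μ.nonneg) (hgh : 0 < μ.pval (g - h)) :
    h ∈ μ.nonneg := by
  simpa using μ.nonneg.sub_mem hg (show g - h ∈ μ.nonneg from hgh.le)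

theorem residualIdeal_anti {f g : k[X]} (h : f ∣ g) : μ.residualIdeal g ≤ μ.residualIdeal f := by
  obtain ⟨r, rfl⟩ := h
  refine Ideal.comap_mono (Ideal.span_singleton_le_span_singleton.2 ?_)
  rw [H_mul]
  exact dvd_mul_right _ _

theorem residualIdeal_pow_le (f : k[X]) (n : ℕ) :
    μ.residualIdeal f ^ n ≤ μ.residualIdeal (f ^ n) := by
  rw [residualIdeal, residualIdeal, H_pow, ← Ideal.span_singleton_pow]
  exact Ideal.le_comap_pow _ n

theorem IsKey.pval_mul_mod (hφ : μ.IsKey φ) {a b : k[X]} (ha : a ≠ 0) (had : a.degree < φ.degree)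
    (hb : b ≠ 0) (hbd : b.degree < φ.degree) : μ.pval (a * b %ₘ φ) = μ.pval (a * b) :=
  pval_mod_eq hφ.monic hφ.isMinimal fun hdvd => (hφ.divides_or_divides hdvd).elim
    (hφ.isMinimal.not_divides ha had) (hφ.isMinimal.not_divides hb hbd)

theorem IsKey.degree_pos (hφ : μ.IsKey φ) : 0 < φ.degree :=
  natDegree_pos_iff_degree_pos.1 hφ.natDegree_pos

theorem IsKey.degree_one_lt (hφ : μ.IsKey φ) : (1 : k[X]).degree < φ.degree :=
  degree_one.trans_lt hφ.degree_pos

theorem IsKey.exists_inverse (hφ : μ.IsKey φ) {a : k[X]} (ha : a ≠ 0) (hd : a.degree < φ.degree) :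
    ∃ b : k[X], b ≠ 0 ∧ b.degree < φ.degree ∧ μ.pval (a * b) = 0 ∧ φ ∣ a * b - 1 := by
  have hm := hφ.monic
  obtain ⟨u, v, huv⟩ : IsCoprime φ a :=
    hφ.irreducible.coprime_iff_not_dvd.2 fun hdvd => (degree_le_of_dvd hdvd ha).not_gt hd
  have hdvd : φ ∣ a * (v %ₘ φ) - 1 :=
    ⟨-u - a * (v /ₘ φ), by linear_combination huv + a * modByMonic_add_div v φ⟩
  have hb : v %ₘ φ ≠ 0 := fun h =>
    hφ.irreducible.not_isUnit (isUnit_of_dvd_one (by simpa [h] using hdvd))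
  have hbd := degree_modByMonic_lt v hm
  refine ⟨v %ₘ φ, hb, hbd, ?_, hdvd⟩
  rw [← hφ.pval_mul_mod ha hd hb hbd, modByMonic_eq_of_dvd_sub hm hdvd,
    (modByMonic_eq_self_iff hm).2 hφ.degree_one_lt, pval_one]

theorem IsKey.exists_reduction_mul_sub_one_mem (hφ : μ.IsKey φ) {x : μ.Delta}
    (hx : x ∉ μ.residualIdeal φ) : ∃ y, x * y - 1 ∈ μ.residualIdeal φ := by
  obtain ⟨g, rfl⟩ := reduction_surjective x
  have hdiv := modByMonic_add_div g.1 φ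
  set a := g.1 %ₘ φ
  have hval : μ.pval a = 0 := by
    refine le_antisymm (not_lt.1 fun hpos => hx (reduction_mem_iff.2 ⟨g.1 /ₘ φ, ?_⟩))
      (le_trans g.2 (pval_le_pval_mod hφ.monic hφ.isMinimal _))
    rwa [← modByMonic_eq_sub_mul_div]
  have ha0 : a ≠ 0 := fun h => WithTop.top_ne_coe (by rwa [h, pval_zero] at hval)
  obtain ⟨b, -, -, hab, c, hc⟩ := hφ.exists_inverse ha0 (degree_modByMonic_lt g.1 hφ.monic)
  rw [pval_mul, hval, zero_add] at hab
  have hmem : μ.reduction (g * ⟨b, hab.ge⟩ - 1) ∈ μ.residualIdeal φ := by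
    refine reduction_mem_of_dvd ⟨c + g.1 /ₘ φ * b, ?_⟩
    change g.1 * b - 1 = _
    linear_combination hc - b * hdiv
  exact ⟨μ.reduction ⟨b, hab.ge⟩, by simpa only [map_sub, map_mul, map_one] using hmem⟩

theorem IsKey.residualIdeal_isMaximal (hφ : μ.IsKey φ) : (μ.residualIdeal φ).IsMaximal := by
  have hprime : (μ.residualIdeal φ).IsPrime := hφ.2.2.2.comap _
  refine Ideal.isMaximal_iff.2 ⟨fun h => hprime.ne_top ((Ideal.eq_top_iff_one _).2 h),
    fun J x hJ hx hxJ => ?_⟩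
  obtain ⟨y, hy⟩ := hφ.exists_reduction_mul_sub_one_mem hx
  simpa using J.sub_mem (J.mul_mem_right y hxJ) (hJ hy)

/-- The group of values of the polynomials of degree less than `deg φ`, where `φ` is a key
polynomial. The powers of `φ` whose value lies in it are those whose graded class becomes
homogeneous of degree zero after multiplication by a unit. -/
def IsKey.smallValues (hφ : μ.IsKey φ) : AddSubgroup ℚ where
  carrier := {r | ∃ a : k[X], a.degree < φ.degree ∧ μ.pval a = (r : WithTop ℚ)}
  zero_mem' := ⟨1, hφ.degree_one_lt, pval_one μ⟩
  add_mem' := by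
    rintro r s ⟨a, had, har⟩ ⟨b, hbd, hbs⟩
    refine ⟨a * b %ₘ φ, degree_modByMonic_lt _ hφ.monic, ?_⟩
    rw [hφ.pval_mul_mod ?_ had ?_ hbd, pval_mul, har, hbs, WithTop.coe_add]
    all_goals
      rintro rfl
      simp [pval_zero] at har hbs
  neg_mem' := by
    rintro r ⟨a, had, har⟩
    have ha : a ≠ 0 := by
      rintro rfl
      simp [pval_zero] at har
    obtain ⟨b, hb, hbd, hab, -⟩ := hφ.exists_inverse ha had
    refine ⟨b, hbd, ?_⟩
    rw [pval_mul, har, μ.pval_eq_coe hb, ← WithTop.coe_add, WithTop.coe_eq_zero] at hab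
    rw [μ.pval_eq_coe hb, eq_neg_of_add_eq_zero_right hab]

theorem IsKey.mem_smallValues_of_pval_pow_mul_eq_zero (hφ : μ.IsKey φ) {n : ℕ} {a : k[X]}
    (ha : a.degree < φ.degree) (hval : μ.pval (φ ^ n * a) = 0) :
    n • μ.qval φ ∈ hφ.smallValues := by
  have ha0 : a ≠ 0 := by
    rintro rfl
    simp [pval_zero] at hval
  rw [pval_mul, pval_pow, μ.pval_eq_coe hφ.monic.ne_zero, μ.pval_eq_coe ha0, ← WithTop.coe_nsmul,
    ← WithTop.coe_add, WithTop.coe_eq_zero] at hval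
  rw [eq_neg_of_add_eq_zero_left hval, neg_mem_iff]
  exact ⟨a, ha, μ.pval_eq_coe ha0⟩

theorem IsKey.residualIdeal_pow_succ (hφ : μ.IsKey φ) {n : ℕ}
    (hn : n • μ.qval φ ∉ hφ.smallValues) :
    μ.residualIdeal (φ ^ (n + 1)) = μ.residualIdeal (φ ^ n) := by
  refine le_antisymm (residualIdeal_anti (pow_dvd_pow φ n.le_succ)) fun x hx => ?_
  obtain ⟨g, rfl⟩ := reduction_surjective x
  obtain ⟨h, hgh⟩ := reduction_mem_iff.1 hx
  have hpos : 0 < μ.pval (φ ^ n * (h %ₘ φ)) := by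
    refine lt_of_le_of_ne ?_ fun h0 => hn (hφ.mem_smallValues_of_pval_pow_mul_eq_zero
      (degree_modByMonic_lt h hφ.monic) h0.symm)
    refine (nonneg_of_pval_sub_pos g.2 hgh).trans ?_
    rw [pval_mul, pval_mul]
    exact add_le_add_right (pval_le_pval_mod hφ.monic hφ.isMinimal h) _
  refine reduction_mem_iff.2 ⟨h /ₘ φ, (lt_min hgh hpos).trans_le ?_⟩
  convert μ.pval_add _ _ using 2
  linear_combination -φ ^ n * modByMonic_add_div h φ

theorem IsKey.residualIdeal_pow_eq (hφ : μ.IsKey φ) {m n : ℕ} (hmn : m ≤ n)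
    (h : ∀ s, m ≤ s → s < n → s • μ.qval φ ∉ hφ.smallValues) :
    μ.residualIdeal (φ ^ n) = μ.residualIdeal (φ ^ m) := by
  induction n, hmn using Nat.le_induction with
  | base => rfl
  | succ n hn ih =>
    rw [hφ.residualIdeal_pow_succ (h n hn n.lt_succ_self)]
    exact ih fun s hms hsn => h s hms (hsn.trans n.lt_succ_self)

theorem IsKey.residualIdeal_pow_mul (hφ : μ.IsKey φ) {e : ℕ} (he : e • μ.qval φ ∈ hφ.smallValues)
    (heq : μ.residualIdeal (φ ^ e) = μ.residualIdeal φ) (n : ℕ) :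
    μ.residualIdeal (φ ^ (e * n)) = μ.residualIdeal φ ^ n := by
  refine le_antisymm (fun x hx => ?_) ?_
  swap
  · rw [pow_mul, ← heq]
    exact residualIdeal_pow_le _ n
  obtain ⟨a, had, ha⟩ := neg_mem he
  have ha0 : a ≠ 0 := by
    rintro rfl
    rw [pval_zero] at ha
    exact WithTop.top_ne_coe ha
  obtain ⟨b, -, -, hab, hb⟩ := hφ.exists_inverse ha0 had
  have hea : μ.pval (φ ^ e * a) = 0 := by
    rw [pval_mul, ha, pval_pow, μ.pval_eq_coe hφ.monic.ne_zero, ← WithTop.coe_nsmul,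
      ← WithTop.coe_add, add_neg_cancel, WithTop.coe_zero]
  obtain ⟨g, rfl⟩ := reduction_surjective x
  obtain ⟨r, hgr⟩ := reduction_mem_iff.1 hx
  have hr := nonneg_of_pval_sub_pos g.2 hgr
  have hfactor : φ ^ (e * n) * r * (a * b) ^ n = (φ ^ e * a) ^ n * (r * b ^ n) := by ring
  have hrb : r * b ^ n ∈ μ.nonneg := by
    have := congrArg μ.pval hfactor
    rw [pval_mul, pval_pow, hab, pval_mul μ ((φ ^ e * a) ^ n), pval_pow, hea, nsmul_zero,
      add_zero, zero_add] at this
    exact hr.trans_eq this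
  rw [show μ.reduction g = μ.reduction ⟨_, hr⟩ from reduction_eq_iff.2 hgr]
  -- `b` is an inverse of `a` modulo `φ`, so that multiplying by `(a b)ⁿ` changes nothing.
  refine mem_pow_of_mul_pow_mem (s := μ.reduction ⟨a * b, hab.ge⟩) ?_ ?_
  · rw [← map_one μ.reduction, ← map_sub]
    exact reduction_mem_of_dvd hb
  · rw [← map_pow, ← map_mul, show (⟨_, hr⟩ * ⟨a * b, hab.ge⟩ ^ n : μ.nonneg) =
      ⟨φ ^ e * a, hea.ge⟩ ^ n * ⟨r * b ^ n, hrb⟩ from Subtype.ext hfactor, map_mul, map_pow]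
    refine Ideal.mul_mem_right _ _ (Ideal.pow_mem_pow ?_ n)
    rw [← heq]
    exact reduction_mem_of_dvd (dvd_mul_right _ _)

theorem IsKey.isOfFinAddOrder_qval (hφ : μ.IsKey φ) (hw : ∃ c : k, addVal (w c) = 1) :
    IsOfFinAddOrder (μ.qval φ : ℚ ⧸ hφ.smallValues) := by
  obtain ⟨c, hc⟩ := hw
  have hone : (1 : ℚ) ∈ hφ.smallValues :=
    ⟨C c, degree_C_le.trans_lt hφ.degree_pos, by rw [pval_C, hc, WithTop.coe_one]⟩
  refine isOfFinAddOrder_iff_nsmul_eq_zero.2 ⟨(μ.qval φ).den, (μ.qval φ).pos, ?_⟩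
  rw [← QuotientAddGroup.mk_nsmul, QuotientAddGroup.eq_zero_iff, nsmul_eq_mul,
    Rat.den_mul_eq_num]
  simpa using zsmul_mem hone (μ.qval φ).num

/-- If `e` is the order of `μ(φ)` modulo `smallValues`, then `ℛ(φ^s)` changes only when `s` exceeds
a multiple of `e`. -/
theorem IsKey.exists_residualIdeal_pow (hφ : μ.IsKey φ) (hw : ∃ c : k, addVal (w c) = 1) {l : ℕ}
    (hl : 0 < l) : ∃ n : ℕ, 0 < n ∧ μ.residualIdeal (φ ^ l) = μ.residualIdeal φ ^ n := by
  set e := addOrderOf (μ.qval φ : ℚ ⧸ hφ.smallValues)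
  have he : 0 < e := (hφ.isOfFinAddOrder_qval hw).addOrderOf_pos
  have hdvd (s : ℕ) : s • μ.qval φ ∈ hφ.smallValues ↔ e ∣ s := by
    rw [addOrderOf_dvd_iff_nsmul_eq_zero, ← QuotientAddGroup.mk_nsmul,
      QuotientAddGroup.eq_zero_iff]
  have hpow_e : μ.residualIdeal (φ ^ e) = μ.residualIdeal φ := by
    have := hφ.residualIdeal_pow_eq (m := 1) (n := e) he fun s hs hse hmem =>
      hse.not_ge (Nat.le_of_dvd hs ((hdvd s).1 hmem))
    rwa [pow_one] at this
  refine ⟨(l - 1) / e + 1, Nat.succ_pos _, ?_⟩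
  have hlt : l - 1 < e * ((l - 1) / e + 1) := Nat.lt_mul_div_succ _ he
  rw [← hφ.residualIdeal_pow_mul ((hdvd e).2 dvd_rfl) hpow_e]
  refine (hφ.residualIdeal_pow_eq (by omega) fun s hls hs hmem => ?_).symm
  obtain ⟨t, rfl⟩ := (hdvd s).1 hmem
  have ht : t ≤ (l - 1) / e := Nat.lt_succ_iff.1 (Nat.lt_of_mul_lt_mul_left hs)
  have := (Nat.mul_le_mul_left e ht).trans (Nat.mul_div_le (l - 1) e)
  omega

end RatVal

/-! ### The valuation of an algebraic extension of a complete field -/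

section AlgVal

variable {k : Type*} [Field k] {w : Valuation k ℤᵐ⁰} {Ω : Type*} [Field Ω] [Algebra k Ω]

theorem algVal_eq_of_minpoly_eq {x y : Ω} (h : minpoly k x = minpoly k y) :
    algVal w x = algVal w y := by
  rw [algVal, algVal, h]

theorem algVal_zero : algVal w (0 : Ω) = ⊤ := by
  simp [algVal, minpoly.zero, addVal_zero]

theorem algVal_one : algVal w (1 : Ω) = 0 := by
  simp [algVal, minpoly.one, addVal_one]

theorem natDegree_nsmul_algVal {x : Ω} (hx : IsIntegral k x) :
    (minpoly k x).natDegree • algVal w x = addVal (w ((minpoly k x).coeff 0)) := by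
  have hn := (minpoly.natDegree_pos hx).ne'
  rw [algVal]
  cases addVal (w ((minpoly k x).coeff 0)) with
  | top =>
    obtain ⟨m, hm⟩ := Nat.exists_eq_succ_of_ne_zero hn
    rw [WithTop.map_top, hm, succ_nsmul, add_top]
  | coe q =>
    rw [WithTop.map_coe, ← WithTop.coe_nsmul, nsmul_eq_mul,
      mul_div_cancel₀ _ (Nat.cast_ne_zero.2 hn)]

theorem algVal_ne_top {x : Ω} (hx : IsIntegral k x) (h0 : x ≠ 0) : algVal w x ≠ ⊤ := by
  rw [algVal, Ne, WithTop.map_eq_top_iff, addVal_eq_top_iff, map_eq_zero]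
  exact minpoly.coeff_zero_ne_zero hx h0

end AlgVal

/-- The order-reversing map `a ↦ 2 ^ (-a)`, with `2 ^ (-∞) = 0`, which turns additive valuations
into absolute values. -/
def twoPowNeg (a : WithTop ℚ) : ℝ := a.recTopCoe 0 fun q => 2 ^ (-(q : ℝ))

theorem twoPowNeg_top : twoPowNeg ⊤ = 0 := rfl

theorem twoPowNeg_coe (q : ℚ) : twoPowNeg q = 2 ^ (-(q : ℝ)) := rfl

theorem twoPowNeg_nonneg (a : WithTop ℚ) : 0 ≤ twoPowNeg a := by
  cases a with
  | top => rfl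
  | coe q => rw [twoPowNeg_coe]; positivity

theorem twoPowNeg_strictAnti : StrictAnti twoPowNeg := by
  intro a b hab
  lift a to ℚ using hab.ne_top
  cases b with
  | top => rw [twoPowNeg_coe, twoPowNeg_top]; positivity
  | coe q =>
    have hlt : (a : ℝ) < q := by exact_mod_cast WithTop.coe_lt_coe.1 hab
    simpa [twoPowNeg_coe, Real.rpow_lt_rpow_left_iff] using hlt

theorem twoPowNeg_add (a b : WithTop ℚ) : twoPowNeg (a + b) = twoPowNeg a * twoPowNeg b := by
  cases a with
  | top => simp [twoPowNeg_top]
  | coe p =>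
    cases b with
    | top => simp [twoPowNeg_top]
    | coe q =>
      rw [← WithTop.coe_add, twoPowNeg_coe, twoPowNeg_coe, twoPowNeg_coe,
        ← Real.rpow_add two_pos, Rat.cast_add, neg_add]

theorem twoPowNeg_nsmul (n : ℕ) (a : WithTop ℚ) : twoPowNeg (n • a) = twoPowNeg a ^ n := by
  induction n with
  | zero => rw [zero_smul, pow_zero, ← WithTop.coe_zero, twoPowNeg_coe]; simp
  | succ n ih => rw [succ_nsmul, twoPowNeg_add, ih, pow_succ]

section Spectral

variable {k : Type*} [NontriviallyNormedField k] [IsUltrametricDist k] [CompleteSpace k]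
  {w : Valuation k ℤᵐ⁰} {Ω : Type*} [Field Ω] [Algebra k Ω] [Algebra.IsAlgebraic k Ω]

theorem spectralNorm_eq_twoPowNeg (hw : ∀ c, ‖c‖ = twoPowNeg (addVal (w c))) (x : Ω) :
    spectralNorm k Ω x = twoPowNeg (algVal w x) := by
  have hx := Algebra.IsIntegral.isIntegral (R := k) x
  have hn := (minpoly.natDegree_pos hx).ne'
  rw [← pow_left_inj₀ (spectralNorm_nonneg x) (twoPowNeg_nonneg _) hn, ← twoPowNeg_nsmul,
    natDegree_nsmul_algVal hx, ← hw, spectralNorm.spectralNorm_eq_norm_coeff_zero_rpow, one_div,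
    Real.rpow_inv_natCast_pow (norm_nonneg _) hn]

theorem algVal_mul_of_norm (hw : ∀ c, ‖c‖ = twoPowNeg (addVal (w c))) (x y : Ω) :
    algVal w (x * y) = algVal w x + algVal w y := by
  apply twoPowNeg_strictAnti.injective
  simp only [twoPowNeg_add, ← spectralNorm_eq_twoPowNeg hw]
  exact spectralAlgNorm_mul x y

theorem min_algVal_le_of_norm (hw : ∀ c, ‖c‖ = twoPowNeg (addVal (w c))) (x y : Ω) :
    min (algVal w x) (algVal w y) ≤ algVal w (x + y) := by
  rw [← twoPowNeg_strictAnti.le_iff_ge, twoPowNeg_strictAnti.antitone.map_min]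
  simp only [← spectralNorm_eq_twoPowNeg hw]
  exact isNonarchimedean_spectralNorm x y

theorem nsmul_algVal_le_of_norm (hw : ∀ c, ‖c‖ = twoPowNeg (addVal (w c))) (x : Ω) (j : ℕ) :
    ((minpoly k x).natDegree - j) • algVal w x ≤ addVal (w ((minpoly k x).coeff j)) := by
  rcases lt_trichotomy j (minpoly k x).natDegree with hj | rfl | hj
  · have hn : (minpoly k x).natDegree - j ≠ 0 := (Nat.sub_pos_of_lt hj).ne'
    have hterm : spectralValueTerms (minpoly k x) j ≤ spectralNorm k Ω x :=
      le_ciSup (spectralValueTerms_bddAbove (minpoly k x)) j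
    rw [spectralValueTerms_of_lt_natDegree _ hj, ← Nat.cast_sub hj.le, one_div] at hterm
    rw [← twoPowNeg_strictAnti.le_iff_ge, twoPowNeg_nsmul, ← hw, ← spectralNorm_eq_twoPowNeg hw,
      ← Real.rpow_inv_natCast_pow (norm_nonneg _) hn]
    gcongr
  · rw [Nat.sub_self, zero_smul, coeff_natDegree,
      minpoly.monic (Algebra.IsIntegral.isIntegral (R := k) x), map_one, addVal_one]
  · simp [coeff_eq_zero_of_natDegree_lt hj, addVal_zero]

end Spectral

/-- The valuation of a valued field with values in `ℤᵐ⁰`. -/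
abbrev fieldVal (k : Type*) [Field k] [Valued k ℤᵐ⁰] : Valuation k ℤᵐ⁰ := Valued.v

section Valued

/-- The rank one structure on a valuation with values in `ℤᵐ⁰` for which the absolute value of a
uniformizer is `1 / 2`. -/
@[reducible]
def rankOneTwo {k : Type*} [Field k] (w : Valuation k ℤᵐ⁰) (hw : ∃ c : k, addVal (w c) = 1) :
    w.RankOne where
  hom' := (WithZeroMulInt.toNNReal (e := 2) two_ne_zero).comp
    MonoidWithZeroHom.ValueGroup₀.embedding
  strictMono' := (WithZeroMulInt.toNNReal_strictMono (e := 2) one_lt_two).comp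
    MonoidWithZeroHom.ValueGroup₀.embedding_strictMono
  exists_val_nontrivial := by
    obtain ⟨c, hc⟩ := hw
    refine ⟨c, fun h => ?_, fun h => ?_⟩
    · simp [h, addVal_zero] at hc
    · simp [h, addVal_one] at hc

theorem toNNReal_eq_twoPowNeg (a : ℤᵐ⁰) :
    (WithZeroMulInt.toNNReal (e := 2) two_ne_zero a : ℝ) = twoPowNeg (addVal a) := by
  by_cases ha : a = 0
  · simp [ha, addVal_zero, twoPowNeg_top]
  rw [addVal_of_ne_zero ha, twoPowNeg_coe, WithZeroMulInt.toNNReal_neg_apply _ ha]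
  push_cast
  rw [neg_neg, Real.rpow_intCast]
  obtain ⟨m, rfl⟩ := WithZero.ne_zero_iff_exists.1 ha
  rfl

variable {k : Type*} [Field k] [Valued k ℤᵐ⁰]

theorem norm_eq_twoPowNeg (hw : ∃ c : k, addVal (fieldVal k c) = 1) (c : k) :
    letI := rankOneTwo (fieldVal k) hw
    letI := Valued.toNontriviallyNormedField k ℤᵐ⁰
    ‖c‖ = twoPowNeg (addVal (fieldVal k c)) := by
  rw [← toNNReal_eq_twoPowNeg]
  change (WithZeroMulInt.toNNReal (e := 2) two_ne_zero (MonoidWithZeroHom.ValueGroup₀.embedding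
    ((fieldVal k).restrict c)) : ℝ) = _
  rw [Valuation.embedding_restrict]

variable [CompleteSpace k] {Ω : Type*} [Field Ω] [Algebra k Ω] [Algebra.IsAlgebraic k Ω]

variable (Ω) in
/-- `algVal` is indeed a valuation of the algebraic extension `Ω` if `k` is complete. -/
def algValuation (hw : ∃ c : k, addVal (fieldVal k c) = 1) : AddValuation Ω (WithTop ℚ) :=
  letI := rankOneTwo (fieldVal k) hw
  letI := Valued.toNontriviallyNormedField k ℤᵐ⁰
  .of (algVal (fieldVal k)) algVal_zero algVal_one
    (min_algVal_le_of_norm (norm_eq_twoPowNeg hw)) (algVal_mul_of_norm (norm_eq_twoPowNeg hw))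

theorem algValuation_apply (hw : ∃ c : k, addVal (fieldVal k c) = 1) (x : Ω) :
    algValuation Ω hw x = algVal (fieldVal k) x := rfl

theorem nsmul_algVal_le (hw : ∃ c : k, addVal (fieldVal k c) = 1) (x : Ω) (j : ℕ) :
    ((minpoly k x).natDegree - j) • algVal (fieldVal k) x ≤
      addVal (fieldVal k ((minpoly k x).coeff j)) :=
  letI := rankOneTwo (fieldVal k) hw
  letI := Valued.toNontriviallyNormedField k ℤᵐ⁰
  nsmul_algVal_le_of_norm (norm_eq_twoPowNeg hw) x j

end Valued

theorem map_multiset_prod_eq_nsmul {R Γ₀ : Type*} [CommRing R]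
    [LinearOrderedAddCommMonoidWithTop Γ₀] (ν : AddValuation R Γ₀) {γ : Γ₀} {s : Multiset R}
    (h : ∀ x ∈ s, ν x = γ) : ν s.prod = s.card • γ := by
  induction s using Multiset.induction_on with
  | empty => simp
  | cons x s ih =>
    rw [Multiset.prod_cons, ν.map_mul, h x (Multiset.mem_cons_self x s),
      ih fun y hy => h y (Multiset.mem_cons_of_mem hy), Multiset.card_cons, succ_nsmul']

section Conjugates

variable {k : Type*} [Field k] {Ω : Type*} [Field Ω] [Algebra k Ω]

theorem minpoly_dvd_comp_minpoly_aeval (θ : Ω) (g : k[X]) :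
    minpoly k θ ∣ (minpoly k (aeval θ g)).comp g :=
  minpoly.dvd k θ (by rw [aeval_comp, minpoly.aeval])

theorem minpoly_aeval_eq_of_isConjRoot [Algebra.IsAlgebraic k Ω] {θ θ' : Ω}
    (h : IsConjRoot k θ θ') (g : k[X]) : minpoly k (aeval θ g) = minpoly k (aeval θ' g) := by
  have hint : IsIntegral k (aeval θ g) := Algebra.IsIntegral.isIntegral _
  refine minpoly.eq_of_irreducible_of_monic (minpoly.irreducible hint) ?_ (minpoly.monic hint)
  obtain ⟨r, hr⟩ := minpoly_dvd_comp_minpoly_aeval θ g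
  rw [← aeval_comp, hr, map_mul, h.aeval_eq_zero, zero_mul]

variable [Valued k ℤᵐ⁰] [CompleteSpace k] [Algebra.IsAlgebraic k Ω] [IsAlgClosed Ω]

theorem algVal_resultant_minpoly (hw : ∃ c : k, addVal (fieldVal k c) = 1) (θ : Ω) (g : k[X]) :
    algVal (fieldVal k)
        (resultant ((minpoly k θ).map (algebraMap k Ω)) (g.map (algebraMap k Ω))) =
      (minpoly k θ).natDegree • algVal (fieldVal k) (aeval θ g) := by
  have hsplits : ((minpoly k θ).map (algebraMap k Ω)).Splits := IsAlgClosed.splits _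
  have hmonic := minpoly.monic (Algebra.IsIntegral.isIntegral (R := k) θ)
  have hconj : ∀ a ∈ ((minpoly k θ).map (algebraMap k Ω)).roots.map
      (g.map (algebraMap k Ω)).eval, algValuation Ω hw a = algVal (fieldVal k) (aeval θ g) := by
    intro a ha
    obtain ⟨θ', hθ', rfl⟩ := Multiset.mem_map.1 ha
    have hroot : IsConjRoot k θ θ' := isConjRoot_of_aeval_eq_zero
      (Algebra.IsIntegral.isIntegral θ) (by simpa [eval_map_algebraMap] using (mem_roots'.1 hθ').2)
    rw [eval_map_algebraMap]
    exact algVal_eq_of_minpoly_eq (minpoly_aeval_eq_of_isConjRoot hroot g).symm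
  rw [resultant_eq_prod_eval _ _ _ le_rfl hsplits, (hmonic.map _).leadingCoeff, one_pow, one_mul,
    ← algValuation_apply hw, map_multiset_prod_eq_nsmul _ hconj, Multiset.card_map,
    ← hsplits.natDegree_eq_card_roots, natDegree_map]

theorem natDegree_nsmul_algVal_comm (hw : ∃ c : k, addVal (fieldVal k c) = 1) (θ ξ : Ω) :
    (minpoly k θ).natDegree • algVal (fieldVal k) (aeval θ (minpoly k ξ)) =
      (minpoly k ξ).natDegree • algVal (fieldVal k) (aeval ξ (minpoly k θ)) := by
  rw [← algVal_resultant_minpoly hw, ← algVal_resultant_minpoly hw, resultant_comm]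
  simp only [← algValuation_apply hw, AddValuation.map_mul, AddValuation.map_pow,
    AddValuation.map_neg, AddValuation.map_one, smul_zero, zero_add]

end Conjugates

/-! ### Comparison of `μ` with the values at a root -/

section Composition

theorem strictMono_nsmul {α : Type*} [AddCommMonoid α] [LinearOrder α]
    [IsOrderedCancelAddMonoid α] {n : ℕ} (hn : n ≠ 0) :
    StrictMono fun a : WithTop α => n • a := by
  intro a b h
  obtain ⟨m, rfl⟩ := Nat.exists_eq_succ_of_ne_zero hn
  lift a to α using h.ne_top
  simp only [succ_nsmul]
  exact WithTop.add_lt_add_of_le_of_lt (WithTop.coe_nsmul a m ▸ WithTop.coe_ne_top)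
    (nsmul_le_nsmul_right h.le m) h

variable {k : Type*} [Field k] {w : Valuation k ℤᵐ⁰} {μ : RatVal w} {φ p g : k[X]} {γ : WithTop ℚ}

namespace RatVal

variable (μ) in
theorem Divides.trans_equivalent {f g h : k[X]} (hfg : μ.Divides f g) (hgh : μ.Equivalent g h) :
    μ.Divides f h :=
  hfg.trans (dvd_of_eq hgh)

theorem pval_C_mul_pow (a : k) (g : k[X]) (j : ℕ) :
    μ.pval (C a * g ^ j) = addVal (w a) + j • μ.pval g := by
  rw [pval_mul, pval_C, pval_pow]

theorem nsmul_le_pval_comp {n : ℕ} (hn : p.natDegree ≤ n)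
    (hp : ∀ j, (n - j) • γ ≤ addVal (w (p.coeff j))) (hg : γ ≤ μ.pval g) :
    n • γ ≤ μ.pval (p.comp g) := by
  rw [comp, eval₂_eq_sum_range]
  refine μ.polyVal.map_le_sum fun j hj => ?_
  have hj : j ≤ n := (Finset.mem_range_succ_iff.1 hj).trans hn
  conv_lhs => rw [← Nat.sub_add_cancel hj, add_nsmul]
  rw [polyVal_apply, pval_C_mul_pow]
  exact add_le_add (hp j) (nsmul_le_nsmul_right hg j)

theorem equivalent_pow_comp (hm : p.Monic)
    (hp : ∀ j, (p.natDegree - j) • γ ≤ addVal (w (p.coeff j))) (hg : μ.pval g < γ) :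
    μ.Equivalent (g ^ p.natDegree) (p.comp g) := by
  have hg0 : g ≠ 0 := fun h => hg.ne_top (μ.pval_eq_top_iff.2 h)
  rw [μ.equivalent_iff (pow_ne_zero _ hg0), pval_sub_comm, comp, eval₂_eq_sum_range,
    Finset.sum_range_succ, coeff_natDegree, hm, C_1, one_mul, add_sub_cancel_right]
  refine μ.polyVal.map_lt_sum (μ.pval_ne_top (pow_ne_zero _ hg0)) fun j hj => ?_
  have hj := Finset.mem_range.1 hj
  rw [polyVal_apply, pval_C_mul_pow, pval_pow]
  refine lt_of_lt_of_le ?_ (add_le_add_left (hp j) _)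
  conv_lhs => rw [← Nat.sub_add_cancel hj.le, add_nsmul]
  rw [← pval_pow _ g j]
  exact (WithTop.add_lt_add_iff_right (μ.pval_ne_top (pow_ne_zero _ hg0))).2
    (strictMono_nsmul (Nat.sub_pos_of_lt hj).ne' hg)

theorem IsKey.divides_of_divides_comp (hφ : μ.IsKey φ) (hm : p.Monic)
    (hp : ∀ j, (p.natDegree - j) • γ ≤ addVal (w (p.coeff j))) (hg : μ.pval g < γ)
    (hdiv : μ.Divides φ (p.comp g)) : μ.Divides φ g :=
  hφ.divides_of_divides_pow (n := p.natDegree)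
    (hdiv.trans_equivalent μ (equivalent_pow_comp hm hp hg).symm)

theorem Divides.exists_lt_pval_sub (hdiv : μ.Divides φ g) (hγ : γ ≠ ⊤) (hg : γ ≤ μ.pval g) :
    ∃ r, γ < μ.pval (g - φ * r) := by
  by_cases h0 : g = 0
  · exact ⟨0, by simpa [h0, pval_zero] using hγ.lt_top⟩
  · exact ((μ.divides_iff h0).1 hdiv).imp fun r hr => hg.trans_lt hr

theorem IsMinimal.not_divides_comp (hφ : μ.IsMinimal φ) (hn : 0 < p.natDegree) (hγ : γ ≠ ⊤)
    (hp : ∀ j, (p.natDegree - j) • γ ≤ addVal (w (p.coeff j)))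
    (hp₀ : p.natDegree • γ = addVal (w (p.coeff 0))) (hg : γ ≤ μ.pval g)
    {s : k[X]} (hs : γ < μ.pval (g - φ * s)) : ¬ μ.Divides φ (p.comp g) := by
  intro hdiv
  lift γ to ℚ using hγ
  have hc : p.coeff 0 ≠ 0 := by
    intro h
    rw [h, map_zero, addVal_zero, ← WithTop.coe_nsmul] at hp₀
    exact WithTop.coe_ne_top hp₀
  set r := p.divX.comp g
  have hr : (p.natDegree - 1) • (γ : WithTop ℚ) ≤ μ.pval r := by
    refine nsmul_le_pval_comp (natDegree_divX_eq_natDegree_tsub_one).le (fun j => ?_) hg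
    rw [coeff_divX, Nat.sub_sub, add_comm 1 j]
    exact hp _
  have hcomp : p.comp g = r * g + C (p.coeff 0) := by
    conv_lhs => rw [← divX_mul_X_add p, add_comp, mul_comp, X_comp, C_comp]
  obtain ⟨t, ht⟩ := hdiv.exists_lt_pval_sub (γ := p.natDegree • (γ : WithTop ℚ))
    (WithTop.coe_nsmul γ _ ▸ WithTop.coe_ne_top) (nsmul_le_pval_comp le_rfl hp hg)
  have hrs : p.natDegree • (γ : WithTop ℚ) < μ.pval (r * (g - φ * s)) := by
    rw [pval_mul]
    conv_lhs => rw [← Nat.sub_add_cancel hn, succ_nsmul]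
    exact WithTop.add_lt_add_of_le_of_lt
      (WithTop.coe_nsmul γ _ ▸ WithTop.coe_ne_top) hr hs
  refine hφ.not_divides (C_ne_zero.2 hc)
    (degree_C_le.trans_lt (natDegree_pos_iff_degree_pos.1 hφ.1))
    ((μ.divides_iff (C_ne_zero.2 hc)).2 ⟨t - r * s, ?_⟩)
  rw [pval_C, ← hp₀, show C (p.coeff 0) - φ * (t - r * s) =
    p.comp g - φ * t - r * (g - φ * s) by rw [hcomp]; ring]
  exact (lt_min ht hrs).trans_le (μ.pval_sub _ _)

end RatVal

end Composition

namespace RatVal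

variable {k : Type*} [Field k] [Valued k ℤᵐ⁰] [CompleteSpace k]
  {Ω : Type*} [Field Ω] [Algebra k Ω] [Algebra.IsAlgebraic k Ω]
  {μ : RatVal (fieldVal k)} {φ : k[X]} {θ : Ω}

theorem IsMinimal.not_divides_minpoly (hφ : μ.IsMinimal φ)
    (hw : ∃ c : k, addVal (fieldVal k c) = 1) {g s : k[X]} (hθ : aeval θ g ≠ 0)
    (hg : algVal (fieldVal k) (aeval θ g) ≤ μ.pval g)
    (hs : algVal (fieldVal k) (aeval θ g) < μ.pval (g - φ * s)) :
    ¬ μ.Divides φ (minpoly k θ) := fun hdiv =>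
  have hint : IsIntegral k (aeval θ g) := Algebra.IsIntegral.isIntegral _
  hφ.not_divides_comp (minpoly.natDegree_pos hint) (algVal_ne_top hint hθ) (nsmul_algVal_le hw _)
    (natDegree_nsmul_algVal hint) hg hs
    (hdiv.trans_dvd μ (minpoly_dvd_comp_minpoly_aeval θ g))

theorem IsMinimal.pval_le_algVal (hφ : μ.IsMinimal φ) (hw : ∃ c : k, addVal (fieldVal k c) = 1)
    (hdiv : μ.Divides φ (minpoly k θ)) (g : k[X]) :
    μ.pval g ≤ algVal (fieldVal k) (aeval θ g) := by
  by_contra! hlt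
  refine hφ.not_divides_minpoly hw (s := 0) (fun h0 => ?_) hlt.le (by simpa using hlt) hdiv
  simp [h0, algVal_zero] at hlt

theorem IsKey.pval_lt_algVal_iff (hφ : μ.IsKey φ) (hw : ∃ c : k, addVal (fieldVal k c) = 1)
    (hdiv : μ.Divides φ (minpoly k θ)) {g : k[X]} (hg : g ≠ 0) :
    μ.pval g < algVal (fieldVal k) (aeval θ g) ↔ μ.Divides φ g := by
  constructor
  · intro hlt
    exact hφ.divides_of_divides_comp
      (minpoly.monic (Algebra.IsIntegral.isIntegral (R := k) (aeval θ g))) (nsmul_algVal_le hw _)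
      hlt (hdiv.trans_dvd μ (minpoly_dvd_comp_minpoly_aeval θ g))
  · intro hg'
    by_contra! hle
    obtain ⟨s, hs⟩ := (μ.divides_iff hg).1 hg'
    refine hφ.isMinimal.not_divides_minpoly hw (fun h0 => ?_) hle (hle.trans_lt hs) hdiv
    exact μ.pval_ne_top hg (top_le_iff.1 (by simpa [h0, algVal_zero] using hle))

end RatVal

/-! ### Prime polynomials divisible by a key polynomial -/

namespace RatVal

variable {k : Type*} [Field k] {w : Valuation k ℤᵐ⁰} {μ : RatVal w} {φ : k[X]}

theorem IsKey.nsmul_le_augVal_comp (hφ : μ.IsKey φ) {δ : WithTop ℚ} (hδ : μ.pval φ ≤ δ)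
    (hδ' : δ ≠ ⊤) {p : k[X]}
    (hp : ∀ j, (p.natDegree - j) • δ ≤ addVal (w (p.coeff j))) :
    p.natDegree • δ ≤ augVal μ.polyVal φ δ (p.comp φ) := by
  rw [← hφ.augValuation_apply hδ hδ', comp, eval₂_eq_sum_range]
  refine (hφ.augValuation hδ hδ').map_le_sum fun j hj => ?_
  rw [hφ.augValuation_apply, mul_comm, augVal_pow_mul hφ.monic hφ.natDegree_pos,
    augVal_of_degree_lt hφ.monic hφ.natDegree_pos (degree_C_le.trans_lt hφ.degree_pos),
    polyVal_apply, pval_C]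
  conv_lhs => rw [← Nat.sub_add_cancel (Finset.mem_range_succ_iff.1 hj), add_nsmul]
  exact add_le_add_left (hp j) _

theorem IsKey.comp_modByMonic (hφ : μ.IsKey φ) (p : k[X]) : p.comp φ %ₘ φ = C (p.coeff 0) := by
  have h : p.comp φ = C (p.coeff 0) + φ * p.divX.comp φ := by
    conv_lhs => rw [← divX_mul_X_add p, add_comp, mul_comp, X_comp, C_comp]
    ring
  rw [h, add_mul_modByMonic hφ.monic (degree_C_le.trans_lt hφ.degree_pos)]

theorem pval_pow_lt_pval_sub_pow (hm : φ.Monic) (hd : 0 < φ.natDegree) {δ : WithTop ℚ}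
    (hδ : μ.pval φ < δ) (hδ' : δ ≠ ⊤) {F : k[X]} {l : ℕ} (hdeg : F.natDegree = l * φ.natDegree)
    (hl : expCoeff φ F l = 1) (hle : l • δ ≤ augVal μ.polyVal φ δ F) :
    μ.pval (φ ^ l) < μ.pval (F - φ ^ l) := by
  induction l generalizing F with
  | zero =>
    have hF : F %ₘ φ = F := (modByMonic_eq_self_iff hm).2
      (degree_lt_degree (by rwa [hdeg, zero_mul]))
    rw [expCoeff_zero, hF] at hl
    simp [hl, pval_zero, pval_one]
  | succ l ih =>
    have hle_min := hle
    rw [← modByMonic_add_div F φ, augVal_add_mul hm hd (degree_modByMonic_lt F hm), le_min_iff,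
      succ_nsmul, WithTop.add_le_add_iff_right hδ', ← succ_nsmul] at hle_min
    have hquot : μ.pval (φ ^ l) < μ.pval (F /ₘ φ - φ ^ l) := by
      refine ih ?_ (by rw [← hl, expCoeff_succ]) hle_min.2
      rw [natDegree_divByMonic F hm, hdeg, add_mul, one_mul, Nat.add_sub_cancel]
    have hrem : μ.pval (φ ^ (l + 1)) < μ.pval (F %ₘ φ) := by
      rw [pval_pow]
      exact (strictMono_nsmul l.succ_ne_zero hδ).trans_le hle_min.1
    have hsub : F - φ ^ (l + 1) = F %ₘ φ + φ * (F /ₘ φ - φ ^ l) := by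
      rw [mul_sub, ← pow_succ', ← add_sub_assoc, modByMonic_add_div F φ]
    rw [hsub]
    refine (lt_min hrem ?_).trans_le (μ.pval_add _ _)
    rw [pow_succ', pval_mul, pval_mul]
    exact (WithTop.add_lt_add_iff_left (μ.pval_ne_top hm.ne_zero)).2 hquot

theorem equivalent_pow_of_expansion (hm : φ.Monic) (hd : 0 < φ.natDegree) {δ : WithTop ℚ}
    (hδ : μ.pval φ < δ) (hδ' : δ ≠ ⊤) {F : k[X]} {l : ℕ} (hdeg : F.natDegree = l * φ.natDegree)
    (hl : expCoeff φ F l = 1) (hle : l • δ ≤ augVal μ.polyVal φ δ F) :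
    μ.Equivalent F (φ ^ l) :=
  ((μ.equivalent_iff (pow_ne_zero l hm.ne_zero)).2
    ((pval_pow_lt_pval_sub_pow hm hd hδ hδ' hdeg hl hle).trans_eq (μ.pval_sub_comm _ _))).symm

theorem IsKey.eq_minpoly (hφ : μ.IsKey φ) {Ω : Type*} [Field Ω] [Algebra k Ω] {θ : Ω}
    (h : aeval θ φ = 0) : φ = minpoly k θ :=
  minpoly.eq_of_irreducible_of_monic hφ.irreducible h hφ.monic

theorem IsKey.exists_minpoly_eq (hφ : μ.IsKey φ) (Ω : Type*) [Field Ω] [Algebra k Ω]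
    [IsAlgClosed Ω] : ∃ ξ : Ω, aeval ξ φ = 0 ∧ minpoly k ξ = φ :=
  (IsAlgClosed.exists_aeval_eq_zero Ω φ hφ.degree_pos.ne').imp fun _ hξ =>
    ⟨hξ, (hφ.eq_minpoly hξ).symm⟩

end RatVal

namespace RatVal

variable {k : Type*} [Field k] [Valued k ℤᵐ⁰] [CompleteSpace k]
  {Ω : Type*} [Field Ω] [Algebra k Ω] [Algebra.IsAlgebraic k Ω]
  {μ : RatVal (fieldVal k)} {φ : k[X]} {θ : Ω}

theorem IsKey.algVal_eq_of_not_divides (hφ : μ.IsKey φ) (hw : ∃ c : k, addVal (fieldVal k c) = 1)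
    (hθ : aeval θ φ = 0) {g : k[X]} (hg : ¬ μ.Divides φ g) :
    algVal (fieldVal k) (aeval θ g) = μ.pval g := by
  have hself : μ.Divides φ (minpoly k θ) := hφ.eq_minpoly hθ ▸ μ.divides_self φ
  have h0 : g ≠ 0 := fun h => hg (h ▸ μ.divides_zero φ)
  exact le_antisymm (not_lt.1 fun h => hg ((hφ.pval_lt_algVal_iff hw hself h0).1 h))
    (hφ.isMinimal.pval_le_algVal hw hself g)

/-- The minimal polynomial `p` of `φ(θ)` gives a multiple `p(φ)` of the minimal polynomial `F` of
`θ` for which the equality is visible. It descends to `F`, because `augVal` is multiplicative. -/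
theorem IsKey.pval_mod_eq_augVal (hφ : μ.IsKey φ) (hw : ∃ c : k, addVal (fieldVal k c) = 1)
    (hθ : aeval θ φ ≠ 0) (hle : μ.pval φ ≤ algVal (fieldVal k) (aeval θ φ)) :
    μ.pval (minpoly k θ %ₘ φ) =
      augVal μ.polyVal φ (algVal (fieldVal k) (aeval θ φ)) (minpoly k θ) := by
  set F := minpoly k θ
  set δ := algVal (fieldVal k) (aeval θ φ)
  set p := minpoly k (aeval θ φ)
  have hint : IsIntegral k (aeval θ φ) := Algebra.IsIntegral.isIntegral _
  have hδ : δ ≠ ⊤ := algVal_ne_top hint hθ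
  obtain ⟨Q, hQ⟩ : F ∣ p.comp φ := minpoly_dvd_comp_minpoly_aeval θ φ
  have hQ0 : Q ≠ 0 := by
    rintro rfl
    have hmod := hφ.comp_modByMonic p
    rw [hQ, mul_zero, zero_modByMonic, eq_comm, C_eq_zero] at hmod
    exact minpoly.coeff_zero_ne_zero hint hθ hmod
  have hprod : μ.pval (F %ₘ φ) + μ.pval (Q %ₘ φ) ≤
      augVal μ.polyVal φ δ F + augVal μ.polyVal φ δ Q := calc
    _ = μ.pval ((F %ₘ φ) * (Q %ₘ φ)) := (μ.pval_mul _ _).symm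
    _ ≤ μ.pval (((F %ₘ φ) * (Q %ₘ φ)) %ₘ φ) := pval_le_pval_mod hφ.monic hφ.isMinimal _
    _ = addVal (fieldVal k (p.coeff 0)) := by
      rw [← mul_modByMonic, ← hQ, hφ.comp_modByMonic, pval_C]
    _ = p.natDegree • δ := (natDegree_nsmul_algVal hint).symm
    _ ≤ augVal μ.polyVal φ δ (p.comp φ) :=
      hφ.nsmul_le_augVal_comp hle hδ (nsmul_algVal_le hw (aeval θ φ))
    _ = _ := by rw [hQ, hφ.augVal_mul hle hδ]
  have hFle := augVal_le_mod (ν := μ.polyVal) (δ := δ) hφ.monic hφ.natDegree_pos F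
  have hQle := augVal_le_mod (ν := μ.polyVal) (δ := δ) hφ.monic hφ.natDegree_pos Q
  refine hFle.antisymm' (not_lt.1 fun hlt => hprod.not_gt ?_)
  exact WithTop.add_lt_add_of_lt_of_le
    (augVal_ne_top hφ.monic hφ.natDegree_pos hδ hQ0) hlt hQle

variable [IsAlgClosed Ω]

theorem IsKey.divides_iff_lt_algVal (hφ : μ.IsKey φ) (hμ : μ.IsInductive)
    (hw : ∃ c : k, addVal (fieldVal k c) = 1) :
    μ.Divides φ (minpoly k θ) ↔ μ.pval φ < algVal (fieldVal k) (aeval θ φ) := by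
  refine ⟨fun h => (hφ.pval_lt_algVal_iff hw h hφ.monic.ne_zero).2 (μ.divides_self φ),
    fun hlt => by_contra fun hdiv => hlt.not_ge ?_⟩
  have hint : IsIntegral k θ := Algebra.IsIntegral.isIntegral _
  have hm := minpoly.monic hint
  have hy : aeval θ φ ≠ 0 := fun h0 => hdiv (hφ.eq_minpoly h0 ▸ μ.divides_self φ)
  obtain ⟨ξ, hξ, hφξ⟩ := hφ.exists_minpoly_eq Ω
  have hcomm := natDegree_nsmul_algVal_comm hw θ ξ
  have hslope := hμ.natDegree_mul_qval_le hφ.monic hφ.isMinimal hm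
  lift algVal (fieldVal k) (aeval θ φ) to ℚ using
    algVal_ne_top (Algebra.IsIntegral.isIntegral _) hy with δ hδ
  rw [hφξ, hφ.algVal_eq_of_not_divides hw hξ hdiv, ← hδ, μ.pval_eq_coe hm.ne_zero,
    ← WithTop.coe_nsmul, ← WithTop.coe_nsmul, WithTop.coe_inj, nsmul_eq_mul, nsmul_eq_mul] at hcomm
  rw [← hcomm] at hslope
  rw [μ.pval_eq_coe hφ.monic.ne_zero, WithTop.coe_le_coe]
  exact le_of_mul_le_mul_left hslope (by exact_mod_cast minpoly.natDegree_pos hint)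

theorem IsKey.natDegree_nsmul_algVal (hφ : μ.IsKey φ) (hw : ∃ c : k, addVal (fieldVal k c) = 1) :
    (minpoly k θ).natDegree • algVal (fieldVal k) (aeval θ φ) =
      φ.natDegree • μ.pval (minpoly k θ %ₘ φ) := by
  obtain ⟨ξ, hξ, hφξ⟩ := hφ.exists_minpoly_eq Ω
  have hcomm := natDegree_nsmul_algVal_comm hw θ ξ
  rw [hφξ, ← aeval_modByMonic_eq_self_of_root hξ] at hcomm
  rw [hcomm]
  by_cases h0 : minpoly k θ %ₘ φ = 0
  · rw [h0, map_zero, algVal_zero, pval_zero]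
  · rw [hφ.algVal_eq_of_not_divides hw hξ
      (hφ.isMinimal.not_divides h0 (degree_modByMonic_lt _ hφ.monic))]

theorem IsKey.exists_expCoeff_eq_one (hφ : μ.IsKey φ) (hμ : μ.IsInductive)
    (hw : ∃ c : k, addVal (fieldVal k c) = 1) (hne : aeval θ φ ≠ 0)
    (hdiv : μ.Divides φ (minpoly k θ)) :
    ∃ l : ℕ, 0 < l ∧ (minpoly k θ).natDegree = l * φ.natDegree ∧
      expCoeff φ (minpoly k θ) l = 1 := by
  have hint : IsIntegral k θ := Algebra.IsIntegral.isIntegral _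
  have hlt := (hφ.divides_iff_lt_algVal hμ hw).1 hdiv
  have hmod := hφ.pval_mod_eq_augVal hw hne hlt.le
  have hrec := hφ.natDegree_nsmul_algVal hw (θ := θ)
  set F := minpoly k θ
  obtain ⟨l, hl, hdeg⟩ := exists_leading_expCoeff hφ.monic hφ.natDegree_pos (minpoly.monic hint)
  have hle := hmod.trans_le (augVal_le hφ.monic hφ.natDegree_pos F l)
  have hslope := hμ.natDegree_mul_qval_le hφ.monic hφ.isMinimal hl
  set r := expCoeff φ F l
  lift algVal (fieldVal k) (aeval θ φ) to ℚ using
    algVal_ne_top (Algebra.IsIntegral.isIntegral _) hne with δ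
  have hr : r.natDegree = 0 := by
    by_contra hr
    refine (strictMono_nsmul hr hlt).not_ge ?_
    have hcancel : (l * φ.natDegree) • (δ : WithTop ℚ) ≠ ⊤ :=
      WithTop.coe_nsmul δ _ ▸ WithTop.coe_ne_top
    refine (WithTop.add_le_add_iff_right hcancel).1 ?_
    calc r.natDegree • (δ : WithTop ℚ) + (l * φ.natDegree) • (δ : WithTop ℚ)
        = φ.natDegree • μ.pval (F %ₘ φ) := by rw [← add_nsmul, ← hdeg, hrec]
      _ ≤ φ.natDegree • (μ.pval r + l • (δ : WithTop ℚ)) := nsmul_le_nsmul_right hle _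
      _ = φ.natDegree • μ.pval r + (l * φ.natDegree) • (δ : WithTop ℚ) := by
        rw [nsmul_add, ← mul_nsmul]
      _ ≤ r.natDegree • μ.pval φ + (l * φ.natDegree) • (δ : WithTop ℚ) := by
        refine add_le_add_left ?_ _
        rw [μ.pval_eq_coe hl.ne_zero, μ.pval_eq_coe hφ.monic.ne_zero]
        exact_mod_cast hslope
  have hdeg' : F.natDegree = l * φ.natDegree := by rw [hdeg, hr, zero_add]
  refine ⟨l, Nat.pos_of_ne_zero ?_, hdeg', hl.natDegree_eq_zero.1 hr⟩
  rintro rfl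
  exact (minpoly.natDegree_pos hint).ne' (hdeg'.trans (zero_mul _))

theorem IsKey.nsmul_algVal_eq (hφ : μ.IsKey φ) (hw : ∃ c : k, addVal (fieldVal k c) = 1) {l : ℕ}
    (hl : (minpoly k θ).natDegree = l * φ.natDegree) :
    l • algVal (fieldVal k) (aeval θ φ) = μ.pval (minpoly k θ %ₘ φ) := by
  have hrec := hφ.natDegree_nsmul_algVal hw (θ := θ)
  rw [hl, mul_comm, mul_nsmul'] at hrec
  exact (strictMono_nsmul hφ.natDegree_pos.ne').injective hrec

end RatVal

/-! ### Newton polygons -/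

section LowerHull

/-- The lower boundary of the convex hull of a set in the plane: the Newton polygon
`μ.newton φ g` is by definition the lower hull of `μ.cloud φ g`. -/
def lowerHull (S : Set (ℝ × ℝ)) : Set (ℝ × ℝ) :=
  {p | p ∈ convexHull ℝ S ∧ ∀ y : ℝ, (p.1, y) ∈ convexHull ℝ S → p.2 ≤ y}

theorem le_map_of_mem_convexHull {E : Type*} [AddCommGroup E] [Module ℝ E] (f : E →ₗ[ℝ] ℝ)
    {S : Set E} {c : ℝ} (hS : ∀ p ∈ S, c ≤ f p) {p : E} (hp : p ∈ convexHull ℝ S) : c ≤ f p :=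
  convexHull_min (t := {p | c ≤ f p}) hS (convex_halfSpace_ge f.isLinear c) hp

theorem convex_insert_fst_lt (q : ℝ × ℝ) : Convex ℝ {p : ℝ × ℝ | p.1 < q.1 ∨ p = q} := by
  rw [convex_iff_forall_pos]
  rintro x hx y hy a b ha hb hab
  have hqa : a * q.1 + b * q.1 = q.1 := by rw [← add_mul, hab, one_mul]
  rcases hx with hx | rfl <;> rcases hy with hy | rfl
  · left
    simp only [Prod.fst_add, Prod.smul_fst, smul_eq_mul]
    nlinarith
  · left
    simp only [Prod.fst_add, Prod.smul_fst, smul_eq_mul]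
    nlinarith
  · left
    simp only [Prod.fst_add, Prod.smul_fst, smul_eq_mul]
    nlinarith
  · right
    rw [← add_smul, hab, one_smul]

variable {S : Set (ℝ × ℝ)} {q : ℝ × ℝ} {c l : ℝ}

theorem isLength_lowerHull (hq : q ∈ S) (hS : ∀ p ∈ S, p.1 < q.1 ∨ p = q) :
    IsLength (lowerHull S) q.1 := by
  have hull : ∀ p ∈ convexHull ℝ S, p.1 < q.1 ∨ p = q :=
    fun p => (convexHull_min hS (convex_insert_fst_lt q) ·)
  refine ⟨⟨q, ⟨subset_convexHull ℝ S hq, fun y hy => ?_⟩, rfl⟩, ?_⟩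
  · exact (congrArg Prod.snd ((hull _ hy).resolve_left (lt_irrefl _))).ge
  · rintro _ ⟨p, hp, rfl⟩
    rcases hull p hp.1 with h | rfl
    exacts [h.le, le_rfl]

theorem le_of_mem_lowerHull (hq : q ∈ S) (hq₀ : 0 < q.1) (h₀ : (0, c) ∈ S)
    (hqc : q.2 + l * q.1 = c) {p : ℝ × ℝ} (hp : p ∈ lowerHull S) (hp₀ : 0 ≤ p.1)
    (hpq : p.1 ≤ q.1) : p.2 + l * p.1 ≤ c := by
  have hseg : (p.1, c - l * p.1) ∈ convexHull ℝ S := by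
    have h := (convex_convexHull ℝ S) (subset_convexHull ℝ S h₀) (subset_convexHull ℝ S hq)
      (sub_nonneg.2 ((div_le_one hq₀).2 hpq)) (div_nonneg hp₀ hq₀.le) (sub_add_cancel _ _)
    convert h using 1
    simp only [Prod.ext_iff, Prod.fst_add, Prod.snd_add, Prod.smul_fst, Prod.smul_snd, smul_eq_mul]
    have := hq₀.ne'
    constructor
    · field_simp
      ring
    · rw [eq_sub_of_add_eq hqc]
      field_simp
      ring
  linarith [hp.2 _ hseg]

theorem isOneSided_lowerHull (hq : q ∈ S) (hq₀ : 0 < q.1) (hqS : ∀ p ∈ S, p.1 < q.1 ∨ p = q)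
    (h₀ : (0, c) ∈ S) (h₀S : ∀ p ∈ S, 0 ≤ p.1) (hqc : q.2 + l * q.1 = c)
    (hS : ∀ p ∈ S, c ≤ p.2 + l * p.1) : IsOneSided (lowerHull S) l := by
  have hlength := isLength_lowerHull hq hqS
  have hnonneg : ∀ p ∈ convexHull ℝ S, 0 ≤ p.1 := fun p hp =>
    le_map_of_mem_convexHull (LinearMap.fst ℝ ℝ ℝ) h₀S hp
  have hge : ∀ p ∈ convexHull ℝ S, c ≤ p.2 + l * p.1 := fun p hp =>
    le_map_of_mem_convexHull (LinearMap.snd ℝ ℝ ℝ + l • LinearMap.fst ℝ ℝ ℝ) hS hp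
  have hcomp : component (lowerHull S) l = lowerHull S :=
    Set.Subset.antisymm (fun p hp => hp.1) fun p hp => ⟨hp, fun r hr =>
      (le_of_mem_lowerHull hq hq₀ h₀ hqc hp (hnonneg p hp.1)
        (hlength.2 (Set.mem_image_of_mem _ hp))).trans (hge r hr.1)⟩
  rw [IsOneSided, hcomp]
  refine ⟨rfl, ⟨⟨(0, c), ⟨subset_convexHull ℝ S h₀, fun y hy => ?_⟩, rfl⟩, ?_⟩, q.1, hlength, hq₀⟩
  · simpa using hge _ hy
  · rintro _ ⟨p, hp, rfl⟩
    exact hnonneg p hp.1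

end LowerHull

namespace RatVal

variable {k : Type*} [Field k] {w : Valuation k ℤᵐ⁰} {μ : RatVal w} {φ F : k[X]} {l : ℕ}

theorem mem_cloud_of_expCoeff_eq_one (hm : φ.Monic) (hl : expCoeff φ F l = 1) :
    ((l : ℝ), ((l * μ.qval φ : ℚ) : ℝ)) ∈ μ.cloud φ F :=
  ⟨l, by rw [hl]; exact one_ne_zero, by rw [hl, one_mul, μ.qval_pow hm.ne_zero]⟩

theorem fst_lt_or_eq_of_mem_cloud (hm : φ.Monic) (hd : 0 < φ.natDegree)
    (hdeg : F.natDegree = l * φ.natDegree) (hl : expCoeff φ F l = 1) :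
    ∀ p ∈ μ.cloud φ F, p.1 < l ∨ p = ((l : ℝ), ((l * μ.qval φ : ℚ) : ℝ)) := by
  rintro _ ⟨s, hs, rfl⟩
  have hsl : s ≤ l := by
    by_contra! h
    exact hs (expCoeff_eq_zero hm (hdeg ▸ Nat.mul_lt_mul_of_pos_right h hd))
  rcases hsl.lt_or_eq with h | rfl
  · exact Or.inl (Nat.cast_lt.2 h)
  · exact Or.inr (by rw [hl, one_mul, μ.qval_pow hm.ne_zero])

theorem isLength_newton (hm : φ.Monic) (hd : 0 < φ.natDegree)
    (hdeg : F.natDegree = l * φ.natDegree) (hl : expCoeff φ F l = 1) :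
    IsLength (μ.newton φ F) l :=
  isLength_lowerHull (mem_cloud_of_expCoeff_eq_one hm hl)
    (fst_lt_or_eq_of_mem_cloud hm hd hdeg hl)

theorem isOneSided_newton (hm : φ.Monic) (hd : 0 < φ.natDegree) (hl₀ : 0 < l)
    (hdeg : F.natDegree = l * φ.natDegree) (hl : expCoeff φ F l = 1) {lam : ℚ}
    (hmod : μ.pval (F %ₘ φ) = l • (μ.pval φ + lam))
    (hle : l • (μ.pval φ + lam) ≤ augVal μ.polyVal φ (μ.pval φ + lam) F) :
    IsOneSided (μ.newton φ F) lam := by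
  rw [μ.pval_eq_coe hm.ne_zero, ← WithTop.coe_add] at hmod hle
  have hF : F %ₘ φ ≠ 0 := fun h => by
    rw [h, pval_zero, ← WithTop.coe_nsmul] at hmod
    exact WithTop.top_ne_coe hmod
  refine isOneSided_lowerHull (c := ((l * (μ.qval φ + lam) : ℚ) : ℝ))
    (mem_cloud_of_expCoeff_eq_one hm hl) (Nat.cast_pos.2 hl₀)
    (fst_lt_or_eq_of_mem_cloud hm hd hdeg hl) ⟨0, hF, ?_⟩ ?_ (by push_cast; ring) ?_
  · rw [μ.pval_eq_coe hF, ← WithTop.coe_nsmul, WithTop.coe_inj, nsmul_eq_mul] at hmod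
    rw [expCoeff_zero, pow_zero, mul_one, hmod, Nat.cast_zero]
  · rintro _ ⟨s, -, rfl⟩
    exact Nat.cast_nonneg s
  · rintro _ ⟨s, hs, rfl⟩
    have hcoeff := hle.trans (augVal_le hm hd F s)
    rw [polyVal_apply, μ.pval_eq_coe hs, ← WithTop.coe_nsmul, ← WithTop.coe_nsmul,
      ← WithTop.coe_add, WithTop.coe_le_coe, nsmul_eq_mul, nsmul_eq_mul] at hcoeff
    have hqval : l * (μ.qval φ + lam) ≤ μ.qval (expCoeff φ F s * φ ^ s) + lam * s := by
      rw [qval_mul μ hs (pow_ne_zero s hm.ne_zero), qval_pow μ hm.ne_zero]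
      linarith
    dsimp only
    exact_mod_cast hqval

end RatVal

namespace RatVal

variable {k : Type*} [Field k] {w : Valuation k ℤᵐ⁰} {μ : RatVal w} {φ : k[X]}

theorem expCoeff_self_one (hm : φ.Monic) (hd : 0 < φ.natDegree) : expCoeff φ φ 1 = 1 := by
  have hself : φ /ₘ φ = 1 := by simpa only [mul_one] using mul_divByMonic_cancel_left 1 hm
  rw [expCoeff_succ, expCoeff_zero, hself, modByMonic_eq_self_iff hm]
  exact degree_lt_degree (by rwa [natDegree_one])

theorem Equivalent.residualIdeal_eq {f g : k[X]} (h : μ.Equivalent f g) :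
    μ.residualIdeal f = μ.residualIdeal g :=
  congrArg (fun x => (Ideal.span {x}).comap (DirectSum.ofZeroRingHom μ.Piece)) h

end RatVal

namespace RatVal

variable {k : Type*} [Field k] [Valued k ℤᵐ⁰] [CompleteSpace k]
  {Ω : Type*} [Field Ω] [Algebra k Ω] [Algebra.IsAlgebraic k Ω] [IsAlgClosed Ω]
  {μ : RatVal (fieldVal k)} {φ : k[X]} {θ : Ω}

theorem IsKey.exists_minpoly_equivalent_pow (hφ : μ.IsKey φ) (hμ : μ.IsInductive)
    (hw : ∃ c : k, addVal (fieldVal k c) = 1) (hdiv : μ.Divides φ (minpoly k θ)) :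
    ∃ l : ℕ, 0 < l ∧ (minpoly k θ).natDegree = l * φ.natDegree ∧
      expCoeff φ (minpoly k θ) l = 1 ∧ μ.Equivalent (minpoly k θ) (φ ^ l) := by
  by_cases hne : aeval θ φ = 0
  · rw [← hφ.eq_minpoly hne]
    exact ⟨1, one_pos, (one_mul _).symm, expCoeff_self_one hφ.monic hφ.natDegree_pos,
      congrArg μ.H (pow_one φ).symm⟩
  obtain ⟨l, hl₀, hdeg, hl⟩ := hφ.exists_expCoeff_eq_one hμ hw hne hdiv
  have hlt := (hφ.divides_iff_lt_algVal hμ hw).1 hdiv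
  refine ⟨l, hl₀, hdeg, hl, equivalent_pow_of_expansion hφ.monic hφ.natDegree_pos hlt
    (algVal_ne_top (Algebra.IsIntegral.isIntegral _) hne) hdeg hl ?_⟩
  rw [hφ.nsmul_algVal_eq hw hdeg, hφ.pval_mod_eq_augVal hw hne hlt.le]

theorem IsKey.eq_or_isOneSided_newton (hφ : μ.IsKey φ) (hμ : μ.IsInductive)
    (hw : ∃ c : k, addVal (fieldVal k c) = 1) (hdiv : μ.Divides φ (minpoly k θ)) :
    minpoly k θ = φ ∨ ∃ lam : ℚ, 0 < lam ∧
      algVal (fieldVal k) (aeval θ φ) = μ.pval φ + lam ∧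
      IsOneSided (μ.newton φ (minpoly k θ)) lam := by
  refine or_iff_not_imp_left.2 fun hF => ?_
  have hne : aeval θ φ ≠ 0 := fun h => hF (hφ.eq_minpoly h).symm
  obtain ⟨l, hl₀, hdeg, hl⟩ := hφ.exists_expCoeff_eq_one hμ hw hne hdiv
  have hlt := (hφ.divides_iff_lt_algVal hμ hw).1 hdiv
  have hmod := hφ.nsmul_algVal_eq hw hdeg
  have haug := hφ.pval_mod_eq_augVal hw hne hlt.le
  lift algVal (fieldVal k) (aeval θ φ) to ℚ using
    algVal_ne_top (Algebra.IsIntegral.isIntegral _) hne with δ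
  have hδ : (δ : WithTop ℚ) = μ.pval φ + (δ - μ.qval φ : ℚ) := by
    rw [μ.pval_eq_coe hφ.monic.ne_zero, ← WithTop.coe_add, add_sub_cancel]
  rw [hδ] at hmod haug
  rw [μ.pval_eq_coe hφ.monic.ne_zero, WithTop.coe_lt_coe] at hlt
  exact ⟨δ - μ.qval φ, sub_pos.2 hlt, hδ, isOneSided_newton hφ.monic hφ.natDegree_pos hl₀ hdeg hl
    hmod.symm (hmod.trans haug).le⟩

end RatVal

/-! ### Construction of inductive valuations -/

section Construction

variable {k : Type*} [Field k] {w : Valuation k ℤᵐ⁰}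

theorem exists_initial_coeff (g : k[X]) : ∃ s, addVal (w (g.coeff s)) = gauss w g ∧
    ∀ i < s, gauss w g < addVal (w (g.coeff i)) := by
  classical
  have hex : ∃ s, addVal (w (g.coeff s)) = gauss w g := by
    by_contra! h
    have htop : gauss w g ≠ ⊤ := fun htop => h 0 (top_le_iff.1 (htop ▸ gauss_le_coeff g 0) |>.trans
      htop.symm)
    exact lt_irrefl _ ((lt_gauss_iff htop).2 fun i => (gauss_le_coeff g i).lt_of_ne' (h i))
  exact ⟨Nat.find hex, Nat.find_spec hex, fun i hi =>
    (gauss_le_coeff g i).lt_of_ne' (Nat.find_min hex hi)⟩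

theorem gauss_mul (g h : k[X]) : gauss w (g * h) = gauss w g + gauss w h := by
  refine le_antisymm ?_ (gauss_add_le_mul g h)
  by_cases hg : g = 0
  · simp [hg, gauss_zero]
  by_cases hh : h = 0
  · simp [hh, gauss_zero]
  obtain ⟨s, hs, hlts⟩ := exists_initial_coeff (w := w) g
  obtain ⟨t, ht, hltt⟩ := exists_initial_coeff (w := w) h
  have hsum : addVal (w (g.coeff s * h.coeff t)) = gauss w g + gauss w h := by
    rw [map_mul, addVal_mul, hs, ht]
  refine (gauss_le_coeff (g * h) (s + t)).trans_eq ?_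
  have hst : (s, t) ∈ Finset.HasAntidiagonal.antidiagonal (s + t) :=
    Finset.HasAntidiagonal.mem_antidiagonal.2 rfl
  rw [coeff_mul, ← Finset.add_sum_erase _ _ hst, ← hsum]
  refine (addValuation w).map_add_eq_of_lt_left ((addValuation w).map_lt_sum ?_ ?_)
  · rw [addValuation_apply, hsum]
    exact WithTop.add_ne_top.2 ⟨gauss_ne_top hg, gauss_ne_top hh⟩
  · rintro ⟨i, j⟩ hij
    simp only [Finset.mem_erase, Finset.HasAntidiagonal.mem_antidiagonal, ne_eq,
      Prod.mk.injEq] at hij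
    rw [addValuation_apply, hsum, AddValuation.map_mul]
    rcases lt_or_ge i s with hi | hi
    · exact WithTop.add_lt_add_of_lt_of_le (gauss_ne_top hh) (hlts i hi) (gauss_le_coeff h j)
    · exact WithTop.add_lt_add_of_le_of_lt (gauss_ne_top hg) (gauss_le_coeff g i)
        (hltt j (by omega))

theorem gauss_C (a : k) : gauss w (C a) = addVal (w a) := by
  by_cases ha : a = 0
  · simp [ha, gauss_zero, addVal_zero]
  · simp [gauss, support_C ha]

variable (w) in
/-- The Gauss valuation on `k[x]`. -/
def gaussValuation : AddValuation k[X] (WithTop ℚ) :=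
  .of (gauss w) gauss_zero (by rw [← C_1, gauss_C, map_one, addVal_one]) min_gauss_le gauss_mul

/-- The extension to `k(x)` of a valuation on `k[x]` with finite values on non-zero polynomials. -/
def extendToRatFunc (ρ : AddValuation k[X] (WithTop ℚ)) (hρ : ∀ g ≠ 0, ρ g ≠ ⊤) :
    AddValuation (RatFunc k) (WithTop ℚ) :=
  .ofValuation (ρ.toValuation.extendToLocalization (S := nonZeroDivisors k[X])
    (fun g hg => hρ g (nonZeroDivisors.ne_zero hg)) (RatFunc k))

theorem extendToRatFunc_algebraMap (ρ : AddValuation k[X] (WithTop ℚ)) (hρ : ∀ g ≠ 0, ρ g ≠ ⊤)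
    (g : k[X]) : extendToRatFunc ρ hρ (algebraMap k[X] (RatFunc k) g) = ρ g :=
  Valuation.extendToLocalization_apply_map_apply ρ.toValuation
    (fun g hg => hρ g (nonZeroDivisors.ne_zero hg)) (RatFunc k) g

namespace RatVal

theorem exists_pval_eq {ρ : AddValuation k[X] (WithTop ℚ)} (hC : ∀ a, ρ (C a) = addVal (w a))
    (hX : 0 ≤ ρ X)
    (hdisc : ∃ e : ℕ, 0 < e ∧ ∀ g ≠ 0, ∃ n : ℤ, ρ g = ((n / e : ℚ) : WithTop ℚ)) :
    ∃ μ : RatVal w, ∀ g, μ.pval g = ρ g := by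
  obtain ⟨e, he₀, he⟩ := hdisc
  have hρ : ∀ g ≠ 0, ρ g ≠ ⊤ := fun g hg => by
    obtain ⟨n, hn⟩ := he g hg
    exact hn ▸ WithTop.coe_ne_top
  refine ⟨⟨extendToRatFunc ρ hρ, fun a => ?_, ?_, e, he₀, fun f hf => ?_⟩,
    extendToRatFunc_algebraMap ρ hρ⟩
  · rw [← RatFunc.algebraMap_C, extendToRatFunc_algebraMap, hC]
  · rwa [← RatFunc.algebraMap_X, extendToRatFunc_algebraMap]
  · obtain ⟨a, b, hb, rfl⟩ := IsFractionRing.div_surjective (A := k[X]) f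
    obtain ⟨m, hm⟩ := he a (by rintro rfl; simp at hf)
    obtain ⟨n, hn⟩ := he b (nonZeroDivisors.ne_zero hb)
    refine ⟨m - n, ?_⟩
    rw [AddValuation.map_div, extendToRatFunc_algebraMap, extendToRatFunc_algebraMap, hm, hn,
      Int.cast_sub, sub_div]
    rfl

theorem exists_pval_eq_gauss (w : Valuation k ℤᵐ⁰) :
    ∃ μ : RatVal w, ∀ g, μ.pval g = gauss w g := by
  refine exists_pval_eq (ρ := gaussValuation w) gauss_C (le_gauss_iff.2 fun i => ?_)
    ⟨1, one_pos, fun g hg => ?_⟩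
  · rw [coeff_X]
    split_ifs <;> simp [addVal_one, addVal_zero]
  · obtain ⟨s, hs, -⟩ := exists_initial_coeff (w := w) g
    have hs₀ : w (g.coeff s) ≠ 0 := fun h => gauss_ne_top hg (by rw [← hs, h, addVal_zero])
    refine ⟨-WithZero.log (w (g.coeff s)), hs.symm.trans ?_⟩
    rw [addVal_of_ne_zero hs₀, Nat.cast_one, div_one]

variable {μ : RatVal w} {φ : k[X]}

theorem exists_augVal_eq_div (hm : φ.Monic) (hd : 0 < φ.natDegree) (l : ℚ) :
    ∃ e : ℕ, 0 < e ∧ ∀ g ≠ 0, ∃ n : ℤ,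
      augVal μ.polyVal φ (μ.pval φ + l) g = ((n / e : ℚ) : WithTop ℚ) := by
  obtain ⟨e, he₀, he⟩ := μ.discrete
  have hval : ∀ a : k[X], a ≠ 0 → ∃ n : ℤ, μ.pval a = ((n / e : ℚ) : WithTop ℚ) := fun a ha =>
    he _ ((map_ne_zero_iff _ (RatFunc.algebraMap_injective k)).2 ha)
  obtain ⟨m, hφ⟩ := hval φ hm.ne_zero
  refine ⟨e * l.den, Nat.mul_pos he₀ l.den_pos, fun g hg => ?_⟩
  obtain ⟨s, -, hs⟩ := Finset.exists_mem_eq_inf (Finset.range (g.natDegree + 1)) ⟨0, by simp⟩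
    fun s => μ.polyVal (expCoeff φ g s) + s • (μ.pval φ + l)
  have hg' : augVal μ.polyVal φ (μ.pval φ + l) g ≠ ⊤ :=
    augVal_ne_top hm hd (WithTop.add_ne_top.2 ⟨μ.pval_ne_top hm.ne_zero, WithTop.coe_ne_top⟩) hg
  rw [augVal, hs] at hg' ⊢
  obtain ⟨n, hn⟩ := hval (expCoeff φ g s) fun h => hg' (by
    rw [h, AddValuation.map_zero, top_add])
  refine ⟨n * l.den + s * (m * l.den + e * l.num), ?_⟩
  rw [polyVal_apply, hn, hφ, ← WithTop.coe_add, ← WithTop.coe_nsmul, ← WithTop.coe_add,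
    WithTop.coe_inj]
  have hl : l * l.den = l.num := Rat.mul_den_eq_num l
  rw [nsmul_eq_mul]
  push_cast
  rw [← hl]
  field_simp

theorem IsKey.exists_isAugmentation (hφ : μ.IsKey φ) {l : ℚ} (hl : 0 ≤ l) :
    ∃ μ' : RatVal w, μ.IsAugmentation φ l μ' := by
  have hle : μ.pval φ ≤ μ.pval φ + l := le_add_of_nonneg_right (WithTop.coe_nonneg.2 hl)
  have htop : μ.pval φ + l ≠ ⊤ :=
    WithTop.add_ne_top.2 ⟨μ.pval_ne_top hφ.monic.ne_zero, WithTop.coe_ne_top⟩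
  have hC : ∀ a, hφ.augValuation hle htop (C a) = addVal (w a) := fun a => by
    rw [hφ.augValuation_apply, augVal_of_degree_lt hφ.monic hφ.natDegree_pos
      (degree_C_le.trans_lt hφ.degree_pos), polyVal_apply, pval_C]
  obtain ⟨μ', hμ'⟩ := exists_pval_eq hC
    (μ.pval_X_nonneg.trans (pval_le_augVal hφ.monic hφ.isMinimal hle _))
    (exists_augVal_eq_div hφ.monic hφ.natDegree_pos l)
  exact ⟨μ', isAugmentation_iff.2 hμ'⟩

end RatVal

end Construction

/-! ### Change of the base field -/

section BaseChange

variable {k k' : Type*} [Field k] [Field k']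

theorem expCoeff_map (i : k →+* k') {φ : k[X]} (hφ : φ.Monic) (g : k[X]) (s : ℕ) :
    expCoeff (φ.map i) (g.map i) s = (expCoeff φ g s).map i := by
  induction s generalizing g with
  | zero => rw [expCoeff_zero, expCoeff_zero, map_modByMonic _ hφ]
  | succ s ih => rw [expCoeff_succ, expCoeff_succ, ← map_divByMonic _ hφ, ih]

theorem augVal_map {Γ₀ : Type*} [LinearOrderedAddCommMonoidWithTop Γ₀]
    {ν : AddValuation k[X] Γ₀} {ν' : AddValuation k'[X] Γ₀} {i : k →+* k'}
    (hν : ∀ g : k[X], ν' (g.map i) = ν g) {φ : k[X]} (hφ : φ.Monic) (δ : Γ₀) (g : k[X]) :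
    augVal ν' (φ.map i) δ (g.map i) = augVal ν φ δ g := by
  simp only [augVal, natDegree_map, expCoeff_map i hφ, hν]

namespace RatVal

variable {w : Valuation k ℤᵐ⁰} {w' : Valuation k' ℤᵐ⁰} {μ : RatVal w} {ν : RatVal w'}
  {i : k →+* k'} (hν : ∀ g : k[X], ν.pval (g.map i) = μ.pval g)

/-- The homomorphism `𝒫_α(μ) → 𝒫_α(ν)` of filtration steps, for `ν` an extension of `μ` to
polynomials over a larger field. -/
def mapP (α : ℚ) : μ.P α →+ ν.P α where
  toFun g := ⟨g.1.map i, ν.mem_P_iff.2 (g.2.trans_eq (hν g).symm)⟩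
  map_zero' := Subtype.ext (Polynomial.map_zero i)
  map_add' _ _ := Subtype.ext (Polynomial.map_add i)

/-- The homomorphism `𝒫_α(μ) / 𝒫_α⁺(μ) → 𝒫_α(ν) / 𝒫_α⁺(ν)` of graded pieces induced by `mapP`. -/
def mapPiece (α : ℚ) : μ.Piece α →+ ν.Piece α :=
  QuotientAddGroup.map _ _ (mapP hν α) fun g hg =>
    (show (α : WithTop ℚ) < μ.pval g from hg).trans_eq (hν g).symm

theorem mapPiece_cls {α : ℚ} (g : μ.P α) : mapPiece hν α (μ.cls g) = ν.cls (mapP hν α g) :=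
  rfl

theorem mapPiece_injective (α : ℚ) : Function.Injective (mapPiece hν α) := by
  intro x y h
  obtain ⟨g, rfl⟩ := μ.cls_surjective x
  obtain ⟨g', rfl⟩ := μ.cls_surjective y
  rw [mapPiece_cls, mapPiece_cls, cls_eq_cls] at h
  rw [cls_eq_cls, ← hν, Polynomial.map_sub]
  exact h

theorem mapPiece_surjective {α : ℚ} (hd : ∀ g : k'[X], ∃ f : k[X], (α : WithTop ℚ) <
    ν.pval (g - f.map i)) : Function.Surjective (mapPiece hν α) := by
  intro y
  obtain ⟨g, rfl⟩ := ν.cls_surjective y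
  obtain ⟨f, hf⟩ := hd g
  have hfα : f ∈ μ.P α := by
    rw [mem_P_iff, ← hν, ← sub_sub_cancel (g : k'[X]) (f.map i)]
    exact (le_min g.2 hf.le).trans (ν.pval_sub _ _)
  refine ⟨μ.cls ⟨f, hfα⟩, ?_⟩
  rw [mapPiece_cls, cls_eq_cls, pval_sub_comm]
  exact hf

/-- The homomorphism `𝒢r(μ) → 𝒢r(ν)` of graded algebras with components `mapPiece`. -/
def mapGr : μ.Gr →+* ν.Gr :=
  DirectSum.toSemiring (fun α => (DirectSum.of ν.Piece α).comp (mapPiece hν α))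
    (ν.of_cls_congr rfl (mapP hν 0 μ.pone) ν.pone (Polynomial.map_one i))
    (by
      intro α β a b
      obtain ⟨g, rfl⟩ := μ.cls_surjective a
      obtain ⟨h, rfl⟩ := μ.cls_surjective b
      exact (ν.of_cls_congr rfl (mapP hν _ (μ.pmul g h)) (ν.pmul (mapP hν α g) (mapP hν β h))
        (Polynomial.map_mul i)).trans
        (DirectSum.of_mul_of (A := ν.Piece) (ν.cls (mapP hν α g)) (ν.cls (mapP hν β h))).symm)

theorem mapGr_of {α : ℚ} (x : μ.Piece α) :
    mapGr hν (DirectSum.of μ.Piece α x) = DirectSum.of ν.Piece α (mapPiece hν α x) :=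
  DirectSum.toSemiring_of _ _ _ _ _

theorem mapGr_bijective (hd : ∀ (g : k'[X]) (α : ℚ), ∃ f : k[X], (α : WithTop ℚ) <
    ν.pval (g - f.map i)) : Function.Bijective (mapGr hν) := by
  have hmap : (mapGr hν : μ.Gr →+ ν.Gr) =
      DirectSum.map (α := μ.Piece) (β := ν.Piece) (mapPiece hν) :=
    DirectSum.addHom_ext fun α x => (mapGr_of hν x).trans (DirectSum.map_of _ _ _).symm
  change Function.Bijective (mapGr hν : μ.Gr →+ ν.Gr)
  rw [hmap]
  exact ⟨(DirectSum.map_injective _).2 (mapPiece_injective hν),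
    (DirectSum.map_surjective _).2 fun α => mapPiece_surjective hν fun g => hd g α⟩

theorem mapGr_H (g : k[X]) : mapGr hν (μ.H g) = ν.H (g.map i) := by
  rw [H, mapGr_of, mapPiece_cls]
  exact ν.of_cls_congr (by rw [qval, qval, hν]) _ _ rfl

include hν in
theorem IsKey.map {φ : k[X]} (hφ : μ.IsKey φ)
    (hd : ∀ (g : k'[X]) (α : ℚ), ∃ f : k[X], f.natDegree ≤ g.natDegree ∧
      (α : WithTop ℚ) < ν.pval (g - f.map i)) : ν.IsKey (φ.map i) := by
  have hd' (g : k'[X]) (α : ℚ) : ∃ f : k[X], (α : WithTop ℚ) < ν.pval (g - f.map i) :=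
    (hd g α).imp fun _ hf => hf.2
  let e : μ.Gr ≃+* ν.Gr := RingEquiv.ofBijective (mapGr hν) (mapGr_bijective hν hd')
  have he (f : k[X]) : e (μ.H f) = ν.H (f.map i) := mapGr_H hν f
  refine ⟨hφ.monic.map i, ⟨(natDegree_map i).symm ▸ hφ.natDegree_pos, fun g hg hlt hdiv => ?_⟩,
    ?_, ?_⟩
  · obtain ⟨f, hfd, hf⟩ := hd g (ν.qval g)
    have hgf : ν.Equivalent g (f.map i) := (ν.equivalent_iff hg).2 (ν.pval_eq_coe hg ▸ hf)
    have hf₀ : f ≠ 0 := by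
      rintro rfl
      rw [Polynomial.map_zero, sub_zero, ν.pval_eq_coe hg] at hf
      exact lt_irrefl _ hf
    rw [natDegree_map] at hlt
    rw [Divides, hgf, ← he, ← he, map_dvd_iff] at hdiv
    exact hφ.isMinimal.2 f hf₀ (hfd.trans_lt hlt) hdiv
  · rw [Ne, Ideal.span_singleton_eq_bot]
    exact ν.H_ne_zero (hφ.monic.map i).ne_zero
  · have hprime := hφ.2.2.2
    rw [← he, ← Set.image_singleton, ← Ideal.map_span]
    exact Ideal.map_isPrime_of_equiv e

theorem ext_pval {μ ν : RatVal w} (h : ∀ g, μ.pval g = ν.pval g) : μ = ν := by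
  refine RatVal.ext (AddValuation.ext fun f => ?_)
  obtain ⟨a, b, -, rfl⟩ := IsFractionRing.div_surjective (A := k[X]) f
  rw [AddValuation.map_div, AddValuation.map_div]
  exact congrArg₂ (· - ·) (h a) (h b)

end RatVal

end BaseChange

/-! ### Extension to the completion -/

section Extension

variable {K : Type*} [Field K] {v : Valuation K ℤᵐ⁰}

theorem complVal_toCompl (a : K) : complVal v (toCompl v a) = v a :=
  Valued.valuedCompletion_apply (K := WithVal v) _

theorem exists_complVal_sub_lt (c : v.Completion) {γ : ℤᵐ⁰} (hγ : γ ≠ 0)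
    (hv : Function.Surjective v) : ∃ a : K, complVal v (c - toCompl v a) < γ := by
  obtain ⟨z, rfl⟩ := hv γ
  have hopen : IsOpen {y : v.Completion | (complVal v).restrict (c - y) <
      (complVal v).restrict (toCompl v z)} :=
    (Valued.isOpen_ball _ _).preimage (continuous_const.sub continuous_id)
  have hmem : (complVal v).restrict (c - c) < (complVal v).restrict (toCompl v z) := by
    rw [Valuation.restrict_lt_iff, sub_self, map_zero, complVal_toCompl]
    exact zero_lt_iff.2 hγ
  obtain ⟨a, ha⟩ := (UniformSpace.Completion.denseRange_coe (α := WithVal v)).exists_mem_open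
    hopen ⟨c, hmem⟩
  exact ⟨WithVal.equiv v a,
    ((complVal v).restrict_lt_iff.1 ha).trans_eq (complVal_toCompl z)⟩

theorem exists_lt_addVal_sub (hv : Function.Surjective v) (c : v.Completion) (T : ℚ) :
    ∃ a : K, (T : WithTop ℚ) < addVal (complVal v (c - toCompl v a)) := by
  obtain ⟨n, hn⟩ := exists_nat_ge T
  obtain ⟨a, ha⟩ := exists_complVal_sub_lt c (WithZero.exp_ne_zero (a := -(n : ℤ))) hv
  refine ⟨a, lt_of_le_of_lt ?_ (addVal_lt_addVal_iff.2 ha)⟩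
  rw [addVal_of_ne_zero WithZero.exp_ne_zero, WithZero.log_exp, neg_neg, Int.cast_natCast]
  exact WithTop.coe_le_coe.2 hn

theorem exists_addVal_complVal_eq_one (hv : Function.Surjective v) :
    ∃ c : v.Completion, addVal (complVal v c) = 1 := by
  obtain ⟨z, hz⟩ := hv (WithZero.exp (-1))
  refine ⟨toCompl v z, ?_⟩
  rw [complVal_toCompl, hz, addVal_of_ne_zero WithZero.exp_ne_zero, WithZero.log_exp, neg_neg,
    Int.cast_one, WithTop.coe_one]

theorem exists_lt_gauss_sub (hv : Function.Surjective v) (g : v.Completion[X]) (T : ℚ) :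
    ∃ f : K[X], f.natDegree ≤ g.natDegree ∧
      (T : WithTop ℚ) < gauss (complVal v) (g - f.map (toCompl v)) := by
  choose a ha using fun i => exists_lt_addVal_sub hv (g.coeff i) T
  refine ⟨∑ i ∈ Finset.range (g.natDegree + 1), monomial i (a i), ?_, ?_⟩
  · refine natDegree_sum_le_of_forall_le _ _ fun i hi => (natDegree_monomial_le _).trans ?_
    exact Nat.lt_succ_iff.1 (Finset.mem_range.1 hi)
  · refine (lt_gauss_iff WithTop.coe_ne_top).2 fun i => ?_
    simp only [coeff_sub, coeff_map, finsetSum_coeff, coeff_monomial, Finset.sum_ite_eq']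
    split_ifs with hi
    · exact ha i
    · rw [coeff_eq_zero_of_natDegree_lt (by rw [Finset.mem_range] at hi; omega), map_zero,
        sub_zero, map_zero, addVal_zero]
      exact WithTop.coe_lt_top T

theorem gauss_map_toCompl (g : K[X]) : gauss (complVal v) (g.map (toCompl v)) = gauss v g :=
  eq_of_forall_le_iff fun T => by simp only [le_gauss_iff, coeff_map, complVal_toCompl]

namespace RatVal

variable {μ : RatVal v} {ν : RatVal (complVal v)}

theorem exists_lt_pval_sub (hv : Function.Surjective v) (ν : RatVal (complVal v))
    (g : v.Completion[X]) (T : ℚ) : ∃ f : K[X], f.natDegree ≤ g.natDegree ∧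
      (T : WithTop ℚ) < ν.pval (g - f.map (toCompl v)) :=
  (exists_lt_gauss_sub hv g T).imp fun _ hf => ⟨hf.1, hf.2.trans_le (ν.gauss_le_pval _)⟩

theorem IsKey.map_toCompl {φ : K[X]} (hφ : μ.IsKey φ)
    (hν : ∀ g : K[X], ν.pval (g.map (toCompl v)) = μ.pval g) (hv : Function.Surjective v) :
    ν.IsKey (φ.map (toCompl v)) :=
  hφ.map hν (exists_lt_pval_sub hv ν)

theorem eq_of_pval_map_toCompl_eq (hv : Function.Surjective v) {ν₁ ν₂ : RatVal (complVal v)}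
    (h : ∀ f : K[X], ν₁.pval (f.map (toCompl v)) = ν₂.pval (f.map (toCompl v))) : ν₁ = ν₂ := by
  refine ext_pval fun g => ?_
  by_cases hg : g = 0
  · rw [hg, pval_zero, pval_zero]
  obtain ⟨f, -, hf⟩ := exists_lt_gauss_sub hv g (max (ν₁.qval g) (ν₂.qval g))
  rw [WithTop.coe_max, max_lt_iff, ← pval_eq_coe _ hg, ← pval_eq_coe _ hg] at hf
  rw [← ν₁.pval_eq_of_lt_sub (hf.1.trans_le (ν₁.gauss_le_pval _)), h,
    ν₂.pval_eq_of_lt_sub (hf.2.trans_le (ν₂.gauss_le_pval _))]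

end RatVal

theorem exists_isNaturalExtension (hv : Function.Surjective v) {μ : RatVal v}
    (hμ : μ.IsInductive) : ∃ ν : RatVal (complVal v), IsNaturalExtension μ ν := by
  induction hμ with
  | minimal μ hμ =>
    obtain ⟨ν, hν⟩ := RatVal.exists_pval_eq_gauss (complVal v)
    exact ⟨ν, .minimal ν hν, fun g => by rw [hν, gauss_map_toCompl, hμ]⟩
  | augment μ μ' φ l _ hφ hl hμ' ih =>
    obtain ⟨ν, hνi, hν⟩ := ih
    have hΦ := hφ.map_toCompl hν hv
    obtain ⟨ν', hν'⟩ := hΦ.exists_isAugmentation hl.le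
    refine ⟨ν', .augment ν ν' _ l hνi hΦ hl hν', fun g => ?_⟩
    rw [RatVal.isAugmentation_iff.1 hν', RatVal.isAugmentation_iff.1 hμ', hν]
    exact augVal_map hν hφ.monic _ g

theorem existsUnique_isNaturalExtension (hv : Function.Surjective v) {μ : RatVal v}
    (hμ : μ.IsInductive) : ∃! ν : RatVal (complVal v), IsNaturalExtension μ ν := by
  obtain ⟨ν, hν⟩ := exists_isNaturalExtension hv hμ
  exact ⟨ν, hν, fun ν' hν' => RatVal.eq_of_pval_map_toCompl_eq hv fun f => by
    rw [hν'.2, hν.2]⟩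

end Extension

end MacLane

end

theorem mainTheorem8 {K : Type*} [Field K] (v : Valuation K ℤᵐ⁰) (hv : Function.Surjective v)
    {Ω : Type*} [Field Ω] [Algebra v.Completion Ω] [IsAlgClosure v.Completion Ω]
    (F : (MacLane.complVal v).valuationSubring[X]) (hFmonic : F.Monic) (hFirr : Irreducible F)
    (θ : Ω) (hθ : aeval θ (F.map (algebraMap _ v.Completion)) = 0)
    (μ : MacLane.RatVal v) (hμ : μ.IsInductive) (φ : K[X]) (hφ : μ.IsKey φ) :
    (∃! μ' : MacLane.RatVal (MacLane.complVal v), MacLane.IsNaturalExtension μ μ') ∧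
    ∀ μ' : MacLane.RatVal (MacLane.complVal v), MacLane.IsNaturalExtension μ μ' →
      ∀ f Φ : v.Completion[X], f = F.map (algebraMap _ v.Completion) →
        Φ = φ.map (MacLane.toCompl v) →
        (μ'.Divides Φ f ↔ μ.pval φ < MacLane.algVal (MacLane.complVal v) (aeval θ Φ)) ∧
        (μ'.Divides Φ f →
          (f = Φ ∨ ∃ l : ℚ, 0 < l ∧
            MacLane.algVal (MacLane.complVal v) (aeval θ Φ) = μ.pval φ + (l : WithTop ℚ) ∧
            MacLane.IsOneSided (μ'.newton Φ f) (l : ℝ)) ∧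
          ∃ ℓ : ℕ, MacLane.IsLength (μ'.newton Φ f) (ℓ : ℝ) ∧
            f.natDegree = ℓ * Φ.natDegree ∧
            μ'.IsMinimal f ∧
            μ'.Equivalent f (Φ ^ ℓ) ∧
            (μ'.residualIdeal Φ).IsMaximal ∧
            ∃ n : ℕ, 0 < n ∧ μ'.residualIdeal f = μ'.residualIdeal Φ ^ n) := by
  have : IsAlgClosed Ω := IsAlgClosure.isAlgClosed v.Completion
  have : Algebra.IsAlgebraic v.Completion Ω := IsAlgClosure.isAlgebraic
  have hw := MacLane.exists_addVal_complVal_eq_one hv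
  refine ⟨MacLane.existsUnique_isNaturalExtension hv hμ, ?_⟩
  rintro ν ⟨hνi, hν⟩ _ Φ rfl rfl
  have hΦ := hφ.map_toCompl hν hv
  rw [minpoly.eq_of_irreducible_of_monic
    (hFmonic.irreducible_iff_irreducible_map_fraction_map.1 hFirr) hθ (hFmonic.map _), ← hν φ]
  refine ⟨hΦ.divides_iff_lt_algVal hνi hw, fun hdiv =>
    ⟨hΦ.eq_or_isOneSided_newton hνi hw hdiv, ?_⟩⟩
  obtain ⟨ℓ, hℓ, hdeg, hcoeff, hequiv⟩ := hΦ.exists_minpoly_equivalent_pow hνi hw hdiv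
  obtain ⟨n, hn, hres⟩ := hΦ.exists_residualIdeal_pow hw hℓ
  exact ⟨ℓ, MacLane.RatVal.isLength_newton hΦ.monic hΦ.natDegree_pos hdeg hcoeff, hdeg,
    hΦ.isMinimal.of_equivalent_pow hΦ.monic hℓ hdeg hequiv, hequiv, hΦ.residualIdeal_isMaximal,
    n, hn, hequiv.residualIdeal_eq.trans hres⟩
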